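/- Let $Y$ be an $n$-dimensional toric Fano manifold with fan $\Sigma$ in $N_{\mathbb R}$, $N\cong\mathbb Z^n$, $M=\operatorname{Hom}(N,\mathbb Z)$; let $v_1,\dots,v_R\in N$ be the primitive ray generators and $D_1,\dots,D_R\in\operatorname{Pic}(Y)$ the classes of the corresponding toric divisors. Let $L_1,\dots,L_c\in\operatorname{Pic}(Y)$ be nef line bundles such that $-K_Y-L_1-\dots-L_c$ is ample. A *nef partition* of $(Y;L_1,\dots,L_c)$ is a partition of $\{1,\dots,R\}$ into sets $S_1,\dots,S_{c+1}$ with $L_i=\sum_{j\in S_i}D_j$ for $1\le i\le c$. An *amenable collection* subordinate to it is a family $u_1,\dots,u_c\in M$ such that for all $1\le i\le c$: $\langle u_i,v_k\rangle=-1$ for $k\in S_i$; $\langle u_i,v_k\rangle\ge 0$ for $k\in S_j$, $i<j\le c+1$; and $\langle u_i,v_k\rangle=0$ for $k\in S_j$, $1\le j<i$. Given such data and elements $s_i\in S_i$ $(1\le i\le c)$, put $W=\sum_{j=1}^R z^{v_j}$ and $G_i=\sum_{j\in S_i}z^{v_j}$ in $\mathbb C[N]$, and define inductively Laurent polynomials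 $F_i\in\mathbb C[u_i^\perp]\subset\mathbb C[N]$ and automorphisms $\mu_i^\star$ of the field $\mathbb C(N)=\operatorname{Frac}\mathbb C[N]$ by $$z^{v_{s_i}}F_i=\mu_{i-1}^\star\cdots\mu_1^\star G_i,\qquad \mu_i^\star(z^v)=z^vF_i^{\langle u_i,v\rangle}\quad(v\in N).$$ The *Laurent polynomial mirror* $f$ attached to $(S_\bullet,u_\bullet,s_\bullet)$ is the restriction of $\mu_c^\star\cdots\mu_1^\star W$ to the subtorus $\{z^{v_{s_1}}=\dots=z^{v_{s_c}}=1\}$, written in coordinates $y_1,\dots,y_{n-c}$ given by any isomorphism of this subtorus with $(\mathbb C^\star)^{n-c}$ (that is, by any isomorphism $N/\langle v_{s_1},\dots,v_{s_c}\rangle\cong\mathbb Z^{n-c}$). Two Laurent polynomials $f,g$ in $m$ variables are *mutation equivalent* if there is a birational map $\varphi\colon(\mathbb C^\star)^m\dashrightarrow(\mathbb C^\star)^m$ with $\varphi^\star f=g$ which is volume preserving, i.e. $\varphi^\star\omega_m=\pm\omega_m$ for $\omega_m=\bigwedge_{i=1}^m d\log y_i$ (a form which itself depends on the choice of coordinates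 of the torus up to sign). Then this construction is always well defined: for every nef partition of $(Y;L_1,\dots,L_c)$, every amenable collection subordinate to it and every choice of $s_i\in S_i$ one has $c\le n$ and a Laurent polynomial mirror $f\in\mathbb C[y_1^{\pm1},\dots,y_{n-c}^{\pm1}]$ exists. Moreover, any two Laurent polynomial mirrors obtained in this way, possibly from different nef partitions of $(Y;L_1,\dots,L_c)$, different amenable collections, and different choices of the $s_i$, are mutation equivalent. -/

import Mathlib

noncomputable section

namespace ToricLG

/-! ### Smooth complete fans, i.e. smooth complete toric varieties -/

/-- The lattice `N` of one-parameter subgroups. -/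
abbrev Latt (n : ℕ) := Fin n → ℤ

/-- The dual lattice `M = Hom(N, ℤ)`. -/
abbrev DualLatt (n : ℕ) := Module.Dual ℤ (Latt n)

/-- The cone in `N ⊗ ℝ` generated by the vectors `v i`, `i ∈ σ`. -/
def realCone {n : ℕ} {ι : Type*} (v : ι → Latt n) (σ : Finset ι) : Set (Fin n → ℝ) :=
  {x | ∃ a : ι → ℝ, (∀ i, 0 ≤ a i) ∧ x = ∑ i ∈ σ, a i • (fun k => (v i k : ℝ))}

/-- A smooth complete fan in `N = ℤⁿ` whose rays are indexed by `ι`. All cones of a smooth fan are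
simplicial, so a cone is recorded by the set of (indices of) its rays. Such a fan is the same thing
as a smooth complete toric variety `Y` of dimension `n`. -/
structure SmoothCompleteFan (n : ℕ) (ι : Type*) [DecidableEq ι] where
  /-- the primitive generators of the rays -/
  ray : ι → Latt n
  /-- the cones of the fan -/
  cones : Set (Finset ι)
  ray_injective : Function.Injective ray
  zero_mem : ∅ ∈ cones
  ray_mem : ∀ i, {i} ∈ cones
  face_mem : ∀ σ ∈ cones, ∀ τ ⊆ σ, τ ∈ cones
  inter_eq : ∀ σ ∈ cones, ∀ τ ∈ cones, realCone ray σ ∩ realCone ray τ = realCone ray (σ ∩ τ)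
  /-- the generators of every cone are part of a `ℤ`-basis of `N` -/
  smooth : ∀ σ ∈ cones, ∃ b : Module.Basis (Fin n) ℤ (Latt n), ∀ i ∈ σ, ray i ∈ Set.range b
  complete : ∀ x : Fin n → ℝ, ∃ σ ∈ cones, x ∈ realCone ray σ

namespace SmoothCompleteFan

variable {n : ℕ} {ι : Type*} [DecidableEq ι]

/-- The map `ρ* : M → (ℤ^R)*`, `m ↦ (⟨m, v_i⟩)_i`; its image consists of the principal
torus-invariant divisors. -/
def rhoStar (Y : SmoothCompleteFan n ι) : DualLatt n →ₗ[ℤ] (ι → ℤ) :=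
  LinearMap.pi fun i => Module.Dual.eval ℤ (Latt n) (Y.ray i)

/-- The Picard group of `Y`: torus-invariant divisors modulo linear equivalence. -/
abbrev Pic (Y : SmoothCompleteFan n ι) : Type _ := (ι → ℤ) ⧸ LinearMap.range Y.rhoStar

/-- The class of the divisor `∑ a_i D_i`. -/
def cls (Y : SmoothCompleteFan n ι) (a : ι → ℤ) : Y.Pic := Submodule.Quotient.mk a

/-- The class `D_i` of the toric prime divisor of the ray `i`. -/
def D (Y : SmoothCompleteFan n ι) (i : ι) : Y.Pic := Y.cls (Pi.single i 1)

/-- A line bundle is nef iff it is represented by a divisor `∑ a_i D_i` with convex support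
function. -/
def IsNef (Y : SmoothCompleteFan n ι) (L : Y.Pic) : Prop :=
  ∃ a : ι → ℤ, Y.cls a = L ∧ ∀ σ, Maximal (· ∈ Y.cones) σ →
    ∃ m : DualLatt n, (∀ i ∈ σ, m (Y.ray i) = -a i) ∧ ∀ j, j ∉ σ → -a j ≤ m (Y.ray j)

/-- A line bundle is ample iff it is represented by a divisor `∑ a_i D_i` with strictly convex
support function. -/
def IsAmple (Y : SmoothCompleteFan n ι) (L : Y.Pic) : Prop :=
  ∃ a : ι → ℤ, Y.cls a = L ∧ ∀ σ, Maximal (· ∈ Y.cones) σ →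
    ∃ m : DualLatt n, (∀ i ∈ σ, m (Y.ray i) = -a i) ∧ ∀ j, j ∉ σ → -a j < m (Y.ray j)

/-- The anticanonical class `-K_Y = ∑ D_i`. -/
def antiK [Fintype ι] (Y : SmoothCompleteFan n ι) : Y.Pic := ∑ i, Y.D i

/-- `Y` is Fano. -/
def IsFano [Fintype ι] (Y : SmoothCompleteFan n ι) : Prop := Y.IsAmple Y.antiK

end SmoothCompleteFan

/-! ### Nef partitions and amenable collections -/

/-- A nef partition of `(Y; L_1, …, L_c)`: a partition of the rays into sets `S_1, …, S_{c+1}`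
(here indexed from `0` to `c`) with `L_i = ∑_{j ∈ S_i} D_j` for the first `c` indices `i`. -/
structure NefPartition {n c : ℕ} {ι : Type*} [DecidableEq ι] [Fintype ι]
    (Y : SmoothCompleteFan n ι) (L : Fin c → Y.Pic) where
  /-- the index of the part that contains a given ray -/
  part : ι → Fin (c + 1)
  sum_eq : ∀ i : Fin c, ∑ j with part j = i.castSucc, Y.D j = L i

namespace NefPartition

variable {n c : ℕ} {ι : Type*} [DecidableEq ι] [Fintype ι]
  {Y : SmoothCompleteFan n ι} {L : Fin c → Y.Pic}

/-- The part `S_i`. -/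
def S (P : NefPartition Y L) (i : Fin (c + 1)) : Finset ι := {j | P.part j = i}

/-- Amenable collections of vectors in `M` subordinate to a nef partition. -/
structure IsAmenable (P : NefPartition Y L) (u : Fin c → DualLatt n) : Prop where
  neg_one : ∀ i : Fin c, ∀ k ∈ P.S i.castSucc, u i (Y.ray k) = -1
  nonneg : ∀ (i : Fin c) (j : Fin (c + 1)), i.castSucc < j → ∀ k ∈ P.S j, 0 ≤ u i (Y.ray k)
  zero : ∀ (i : Fin c) (j : Fin (c + 1)), j < i.castSucc → ∀ k ∈ P.S j, u i (Y.ray k) = 0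

end NefPartition

/-! ### Laurent polynomials, birational maps of tori, mutations -/

/-- The ring `ℂ[N]` of Laurent polynomials, the coordinate ring of an `n`-dimensional torus. -/
abbrev Laurent (n : ℕ) := AddMonoidAlgebra ℂ (Latt n)

/-- The field of rational functions of an `n`-dimensional torus. -/
abbrev FunField (n : ℕ) := FractionRing (Laurent n)

/-- The monomial `z^v`. -/
def mono {n : ℕ} (v : Latt n) : Laurent n := AddMonoidAlgebra.single v 1

/-- A Laurent polynomial as a rational function. -/
abbrev toFun {n : ℕ} (f : Laurent n) : FunField n := algebraMap (Laurent n) (FunField n) f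

/-- The pull-back of rational functions along birational self-maps of the torus: these are the
`ℂ`-automorphisms of the function field. -/
abbrev BirMap (n : ℕ) := FunField n ≃ₐ[ℂ] FunField n

/-- `μ` is (the pull-back along) the algebraic mutation with weight vector `w` and factor
`F ∈ ℂ[w^⊥]`, that is `z^v ↦ z^v F^{-⟨w,v⟩}`. -/
structure IsMutation {n : ℕ} (w : DualLatt n) (F : Laurent n) (μ : BirMap n) : Prop where
  factor_ne_zero : F ≠ 0
  factor_mem : ∀ v ∈ F.coeff.support, w v = 0
  map_mono : ∀ v : Latt n, μ (toFun (mono v)) = toFun (mono v) * toFun F ^ (-(w v))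

/-- The pull-backs `f ↦ μ_j (… (μ_1 f))` along the first `j` members of a finite sequence of
birational maps. -/
def iterPull {n c : ℕ} (μ : Fin c → BirMap n) (j : Fin (c + 1)) : BirMap n :=
  Fin.induction (motive := fun _ => BirMap n) AlgEquiv.refl (fun i e => e.trans (μ i)) j

/-- The form `d log x_1 ∧ ⋯ ∧ d log x_m`, a Kähler differential of top degree. -/
def dlogForm {m : ℕ} (x : Fin m → FunField m) :
    ⋀[FunField m]^m (Ω[FunField m⁄ℂ]) :=
  exteriorPower.ιMulti (FunField m) m
    fun i => (x i)⁻¹ • KaehlerDifferential.D ℂ (FunField m) (x i)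

/-- The coordinate functions on the torus. -/
def coord (m : ℕ) (i : Fin m) : FunField m := toFun (mono (Pi.single i 1))

/-- `φ` preserves the form `ω_m = d log y_1 ∧ ⋯ ∧ d log y_m`; this form depends on the choice of
coordinates of the torus up to sign, and is accordingly preserved up to sign. Note that
`φ^* ω_m = d log φ^*(y_1) ∧ ⋯ ∧ d log φ^*(y_m)`. -/
def IsVolumePreserving {m : ℕ} (φ : BirMap m) : Prop :=
  dlogForm (fun i => φ (coord m i)) = dlogForm (coord m) ∨
    dlogForm (fun i => φ (coord m i)) = -dlogForm (coord m)

/-- Mutation equivalence of Laurent polynomials. -/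
def MutationEquivalent {m : ℕ} (f g : Laurent m) : Prop :=
  ∃ φ : BirMap m, IsVolumePreserving φ ∧ φ (toFun f) = toFun g

/-! ### Laurent polynomial mirrors -/

section mirror

variable {n c : ℕ} {ι : Type*} [DecidableEq ι] [Fintype ι]
  {Y : SmoothCompleteFan n ι} {L : Fin c → Y.Pic}

/-- The superpotential `W`, the sum of all `z^{v_j}`. -/
def superpotential (Y : SmoothCompleteFan n ι) : Laurent n := ∑ j, mono (Y.ray j)

/-- The polynomial `G_i = ∑_{j ∈ S_i} z^{v_j}`. -/
def NefPartition.G (P : NefPartition Y L) (i : Fin (c + 1)) : Laurent n :=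
  ∑ j ∈ P.S i, mono (Y.ray j)

/-- `f` is the Laurent polynomial mirror obtained from the nef partition `P`, the amenable
collection `u` and the distinguished rays `s_i ∈ S_i`.

The mutations `μ_i` have weight `-u_i`, i.e. `z^v ↦ z^v F_i^{⟨u_i,v⟩}`, and their factors satisfy
`z^{v_{s_i}} F_i = μ_{i-1} (⋯ (μ_1 G_i))`. The pull-back `H` of `W` along all of them is restricted
to the subtorus `{z^{v_{s_1}} = ⋯ = z^{v_{s_c}} = 1}`. The homomorphism `q : N → ℤ^{n-c}`, which
is onto with kernel generated by the `v_{s_i}`, is a choice of coordinates on that subtorus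
(the restriction of `z^v` to it is `y^{q(v)}`). -/
def IsLaurentMirror (P : NefPartition Y L) (u : Fin c → DualLatt n) (s : Fin c → ι)
    (f : Laurent (n - c)) : Prop :=
  ∃ (F : Fin c → Laurent n) (μ : Fin c → BirMap n) (H : Laurent n) (q : Latt n →+ Latt (n - c)),
    (∀ i, IsMutation (-u i) (F i) (μ i)) ∧
    (∀ i, toFun (mono (Y.ray (s i)) * F i) = iterPull μ i.castSucc (toFun (P.G i.castSucc))) ∧
    toFun H = iterPull μ (Fin.last c) (toFun (superpotential Y)) ∧
    Function.Surjective q ∧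
    q.ker = AddSubgroup.closure (Set.range fun i => Y.ray (s i)) ∧
    f = AddMonoidAlgebra.mapDomain q H

end mirror

end ToricLG

end

/-!
Points of the torus over a field `K` are characters `p : N → Kˣ`. A mirror of `(P, u, s)` is `W`
restricted to the locus `G_1 = ⋯ = G_c = 1`: this locus is parametrised birationally by the torus
of `⋂ u_i^⊥`, because the triangular shape of an amenable collection lets the equations `G_i = 1`
be solved recursively for the remaining coordinates, and the factors `F_i` of the mutations are
exactly the solutions.

The corresponding parts of two nef partitions of the same line bundles are linearly equivalent:
there are `M_a ∈ M` with `⟨M_a, v_j⟩ = [v_j ∈ S_a] - [v_j ∈ S'_a]`. Twisting a point of the second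
locus by `∏_a B_a^{-M_a}` multiplies the `j`-th monomial by `B_{part' j} / B_{part j}`, and the
result lies on the first locus precisely when `B` is killed by the Laplacian of the weighted
digraph on `{0, …, c}` with an edge `part j → part' j` of weight `z^{v_j}` for every ray `j`. As the
fan is complete, the rays satisfy a positive linear relation, which is a positive circulation on
this digraph, so that every weak component is strongly connected and carries a unique `B`, up to
scaling; rational functions that are positive at the unit of the torus certify that all `B_a` and
the relevant minors are nonzero. This gives a birational map between the two loci that preserves
`W`.

It preserves the volume form up to sign: the logarithmic differential of the twist is
`J = 1 - ∑_a (d log B_a) ⊗ M_a`, and `det J = ± 1` since differentiating the equation of `B`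
expresses `J` on the span of the `M_a` through the Laplacian and its transpose, which have the same
minors. The loci themselves carry the residue form of `d log z / ∏ d G_i`, which the two
parametrisations turn into the standard volume form by unimodularity.
-/

noncomputable section

namespace ToricLG

open Finset

/-! ### Points of tori and evaluation of Laurent polynomials -/

section points

variable {n : ℕ}

theorem mono_zero : mono (0 : Latt n) = 1 := rfl

theorem mono_add (v w : Latt n) : mono (v + w) = mono v * mono w := by
  simp only [mono, AddMonoidAlgebra.single_mul_single, mul_one]

theorem mono_mul_right_injective (v : Latt n) : Function.Injective (mono v * ·) := fun f g h => by
  have := congrArg (mono (-v) * ·) h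
  simpa only [← mul_assoc, ← mono_add, neg_add_cancel, mono_zero, one_mul] using this

theorem eq_sum_smul_mono (f : Laurent n) : f = ∑ v ∈ f.coeff.support, f.coeff v • mono v := by
  conv_lhs => rw [← AddMonoidAlgebra.sum_coeff_single f]
  simp only [Finsupp.sum, mono, AddMonoidAlgebra.smul_single, smul_eq_mul, mul_one]

theorem algHom_ext_mono {A : Type*} [Semiring A] [Algebra ℂ A] {f g : Laurent n →ₐ[ℂ] A}
    (h : ∀ v, f (mono v) = g (mono v)) : f = g :=
  AddMonoidAlgebra.algHom_ext h (by ext)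

theorem toFun_injective : Function.Injective (toFun : Laurent n → FunField n) :=
  IsFractionRing.injective _ _

theorem toFun_ne_zero {f : Laurent n} (hf : f ≠ 0) : toFun f ≠ 0 :=
  (map_ne_zero_iff _ toFun_injective).mpr hf

variable {K : Type*} [Field K]

theorem addChar_ne_zero (p : AddChar (Latt n) K) (v : Latt n) : p v ≠ 0 :=
  (p.val_isUnit v).ne_zero

theorem addChar_map_sum {G A κ : Type*} [AddCommMonoid G] [CommMonoid A] (p : AddChar G A)
    (t : Finset κ) (x : κ → G) : p (∑ i ∈ t, x i) = ∏ i ∈ t, p (x i) :=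
  map_sum p.toAddMonoidHom x t

theorem addChar_apply_eq_prod (p : AddChar (Latt n) K) (v : Latt n) :
    p v = ∏ i, p (Pi.single i 1) ^ v i := by
  conv_lhs => rw [pi_eq_sum_univ' v]
  simp only [addChar_map_sum, AddChar.map_zsmul_eq_zpow]

/-- The character `v ↦ b ^ ⟨w, v⟩` of `N`: the value at `b` of the one-parameter subgroup `w ∈ M` of
the torus with character lattice `N`. -/
def cochar (b : K) (hb : b ≠ 0) (w : DualLatt n) : AddChar (Latt n) K where
  toFun v := b ^ w v
  map_zero_eq_one' := by rw [map_zero, zpow_zero]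
  map_add_eq_mul' v v' := by rw [map_add, zpow_add₀ hb]

@[simp]
theorem cochar_apply (b : K) (hb : b ≠ 0) (w : DualLatt n) (v : Latt n) :
    cochar b hb w v = b ^ w v := rfl

variable [Algebra ℂ K]

/-- Evaluation of Laurent polynomials at a `K`-point of the torus, which is the same thing as a
character of `N` with values in `Kˣ`. -/
def evalAt (p : AddChar (Latt n) K) : Laurent n →ₐ[ℂ] K :=
  AddMonoidAlgebra.lift ℂ K (Latt n) p.toMonoidHom

@[simp]
theorem evalAt_mono (p : AddChar (Latt n) K) (v : Latt n) : evalAt p (mono v) = p v := by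
  simp only [evalAt, mono, AddMonoidAlgebra.lift_single, AddChar.toMonoidHom_apply, toAdd_ofAdd,
    one_smul]

theorem evalAt_mapDomain {m : ℕ} (p : AddChar (Latt m) K) (q : Latt n →+ Latt m) (f : Laurent n) :
    evalAt p (AddMonoidAlgebra.mapDomain q f) = evalAt (p.compAddMonoidHom q) f := by
  have h : (evalAt p).comp (AddMonoidAlgebra.mapDomainAlgHom ℂ ℂ q)
      = evalAt (p.compAddMonoidHom q) := algHom_ext_mono fun v => by
    rw [AlgHom.comp_apply, evalAt_mono, AddChar.compAddMonoidHom_apply, ← evalAt_mono p (q v)]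
    exact congrArg _ AddMonoidAlgebra.mapDomain_single
  exact DFunLike.congr_fun h f

/-- The field generated by the coordinates of a point of the torus. -/
def residueField (p : AddChar (Latt n) K) : IntermediateField ℂ K :=
  IntermediateField.adjoin ℂ (Set.range p)

theorem apply_mem_residueField (p : AddChar (Latt n) K) (v : Latt n) : p v ∈ residueField p :=
  IntermediateField.subset_adjoin ℂ _ (Set.mem_range_self v)

theorem residueField_le_iff {p : AddChar (Latt n) K} {E : IntermediateField ℂ K} :
    residueField p ≤ E ↔ ∀ v, p v ∈ E :=
  IntermediateField.adjoin_le_iff.trans Set.range_subset_iff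

theorem evalAt_mem {p : AddChar (Latt n) K} {E : IntermediateField ℂ K} {f : Laurent n}
    (h : ∀ v ∈ f.coeff.support, p v ∈ E) : evalAt p f ∈ E := by
  rw [eq_sum_smul_mono f, map_sum]
  refine sum_mem fun v hv => ?_
  rw [map_smul, evalAt_mono]
  exact E.smul_mem (h v hv)

/-- The generic point of the torus. -/
def genericPoint (n : ℕ) : AddChar (Latt n) (FunField n) where
  toFun v := toFun (mono v)
  map_zero_eq_one' := map_one _
  map_add_eq_mul' v w := by rw [mono_add, toFun, map_mul]

@[simp]
theorem genericPoint_apply (v : Latt n) : genericPoint n v = toFun (mono v) := rfl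

theorem evalAt_genericPoint (f : Laurent n) : evalAt (genericPoint n) f = toFun f := by
  have h : evalAt (genericPoint n) = Algebra.algHom ℂ (Laurent n) (FunField n) :=
    algHom_ext_mono fun v => evalAt_mono _ v
  exact DFunLike.congr_fun h f

theorem residueField_genericPoint : residueField (genericPoint n) = ⊤ := by
  refine eq_top_iff.mpr fun y _ => ?_
  obtain ⟨a, b, _, rfl⟩ := IsFractionRing.div_surjective (A := Laurent n) y
  have h (f : Laurent n) : toFun f ∈ residueField (genericPoint n) := by
    rw [← evalAt_genericPoint]
    exact evalAt_mem fun v _ => apply_mem_residueField _ v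
  exact div_mem (h a) (h b)

end points

/-! ### Birational maps defined by generating points -/

section birational

variable {m : ℕ}

/-- The inclusion of the exponents of polynomials into those of Laurent polynomials. -/
def expHom (m : ℕ) : (Fin m →₀ ℕ) →+ Latt m where
  toFun s i := s i
  map_zero' := by ext; simp
  map_add' _ _ := by ext; simp

theorem expHom_injective : Function.Injective (expHom m) := fun _ _ h =>
  Finsupp.ext fun i => Nat.cast_injective (R := ℤ) (congrFun h i)

theorem expHom_single (i : Fin m) : expHom m (Finsupp.single i 1) = Pi.single i 1 := by
  ext j
  simp [expHom, Finsupp.single_apply, Pi.single_apply, eq_comm]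

/-- The inclusion of polynomials into Laurent polynomials. -/
def polyIncl (m : ℕ) : MvPolynomial (Fin m) ℂ →ₐ[ℂ] Laurent m :=
  AddMonoidAlgebra.mapDomainAlgHom ℂ ℂ (expHom m)

theorem polyIncl_injective : Function.Injective (polyIncl m) :=
  AddMonoidAlgebra.mapDomain_injective expHom_injective

theorem polyIncl_monomial (s : Fin m →₀ ℕ) (r : ℂ) :
    polyIncl m (MvPolynomial.monomial s r) = AddMonoidAlgebra.single (expHom m s) r :=
  AddMonoidAlgebra.mapDomain_single

theorem evalAt_polyIncl {K : Type*} [Field K] [Algebra ℂ K] (p : AddChar (Latt m) K)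
    (g : MvPolynomial (Fin m) ℂ) :
    evalAt p (polyIncl m g) = MvPolynomial.aeval (fun i => p (Pi.single i 1)) g := by
  have h : (evalAt p).comp (polyIncl m) = MvPolynomial.aeval fun i => p (Pi.single i 1) :=
    MvPolynomial.algHom_ext fun i => by
      rw [AlgHom.comp_apply, MvPolynomial.aeval_X, MvPolynomial.X, polyIncl_monomial,
        expHom_single]
      exact evalAt_mono p _
  exact DFunLike.congr_fun h g

theorem exists_mono_mul_eq_polyIncl (f : Laurent m) :
    ∃ s g, mono (expHom m s) * f = polyIncl m g := by
  induction f using AddMonoidAlgebra.induction_linear with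
  | zero => exact ⟨0, 0, by simp⟩
  | add f f' hf hf' =>
    obtain ⟨s, g, hg⟩ := hf
    obtain ⟨s', g', hg'⟩ := hf'
    refine ⟨s + s', MvPolynomial.monomial s' 1 * g + MvPolynomial.monomial s 1 * g', ?_⟩
    simp only [map_add, map_mul, polyIncl_monomial, ← hg, ← hg', mono_add]
    simp only [mono]
    ring
  | single v r =>
    have hv : expHom m (Finsupp.equivFunOnFinite.symm fun i => (-v i).toNat) + v
        = expHom m (Finsupp.equivFunOnFinite.symm fun i => (v i).toNat) := by
      ext i
      change ((-v i).toNat : ℤ) + v i = (v i).toNat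
      lia
    exact ⟨_, MvPolynomial.monomial _ r, by
      rw [mono, AddMonoidAlgebra.single_mul_single, one_mul, hv, polyIncl_monomial]⟩

theorem algebraicIndependent_coord : AlgebraicIndependent ℂ (coord m) := fun f g h => by
  refine polyIncl_injective (toFun_injective ?_)
  rw [← evalAt_genericPoint, ← evalAt_genericPoint, evalAt_polyIncl, evalAt_polyIncl]
  exact h

theorem adjoin_coord_eq_residueField {K : Type*} [Field K] [Algebra ℂ K] (p : AddChar (Latt m) K) :
    IntermediateField.adjoin ℂ (Set.range fun i => p (Pi.single i 1)) = residueField p := by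
  refine le_antisymm (IntermediateField.adjoin_le_iff.mpr ?_) (residueField_le_iff.mpr fun v => ?_)
  · rintro _ ⟨i, rfl⟩
    exact apply_mem_residueField p _
  · rw [addChar_apply_eq_prod]
    exact prod_mem fun i _ =>
      zpow_mem (IntermediateField.subset_adjoin ℂ _ (Set.mem_range_self i)) _

theorem algebraicIndependent_of_adjoin_eq_top {x : Fin m → FunField m}
    (hx : IntermediateField.adjoin ℂ (Set.range x) = ⊤) : AlgebraicIndependent ℂ x := by
  have halg : Algebra.IsAlgebraic (Algebra.adjoin ℂ (Set.range x)) (FunField m) := by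
    refine ⟨fun y => ?_⟩
    have hy : y ∈ IntermediateField.adjoin ℂ (Set.range x) := hx ▸ IntermediateField.mem_top
    obtain ⟨r, hr, s, hs, rfl⟩ := (IntermediateField.mem_adjoin_iff_div).mp hy
    rw [div_eq_mul_inv]
    exact (isAlgebraic_algebraMap (⟨r, hr⟩ : Algebra.adjoin ℂ (Set.range x))).mul
      (isAlgebraic_algebraMap (⟨s, hs⟩ : Algebra.adjoin ℂ (Set.range x))).inv
  exact (Algebra.IsAlgebraic.isTranscendenceBasis_of_le_trdeg_of_finite ℂ x
    algebraicIndependent_coord.cardinalMk_le_trdeg).1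

theorem evalAt_injective {p : AddChar (Latt m) (FunField m)} (hp : residueField p = ⊤) :
    Function.Injective (evalAt p) := by
  have hind := algebraicIndependent_of_adjoin_eq_top ((adjoin_coord_eq_residueField p).trans hp)
  refine (injective_iff_map_eq_zero _).mpr fun f hf => ?_
  obtain ⟨s, g, hg⟩ := exists_mono_mul_eq_polyIncl f
  have hg0 : g = 0 := hind (by
    rw [← evalAt_polyIncl, ← hg, map_mul, hf, mul_zero, map_zero])
  exact mono_mul_right_injective (expHom m s) (by simp only [hg, hg0, map_zero, mul_zero])

theorem exists_birMap {p : AddChar (Latt m) (FunField m)} (hp : residueField p = ⊤) :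
    ∃ φ : BirMap m, ∀ f, φ (toFun f) = evalAt p f := by
  let ψ : FunField m →ₐ[ℂ] FunField m := IsFractionRing.liftAlgHom (evalAt_injective hp)
  have hψ (f : Laurent m) : ψ (toFun f) = evalAt p f :=
    IsFractionRing.lift_algebraMap (evalAt_injective hp) f
  have hsurj : Function.Surjective ψ := by
    rw [← AlgHom.fieldRange_eq_top, eq_top_iff, ← hp, residueField_le_iff]
    exact fun v => ⟨toFun (mono v), (hψ _).trans (evalAt_mono p v)⟩
  exact ⟨AlgEquiv.ofBijective ψ ⟨ψ.toRingHom.injective, hsurj⟩, hψ⟩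

end birational

/-! ### Existence of mutations -/

section mutation

variable {n : ℕ} {w : DualLatt n}

/-- The ring `ℂ[w^⊥]` of Laurent polynomials all of whose exponents are orthogonal to `w ∈ M`. -/
def orthSubalgebra (w : DualLatt n) : Subalgebra ℂ (Laurent n) where
  carrier := {f | ∀ v ∈ f.coeff.support, w v = 0}
  mul_mem' hf hg := (add_zero (0 : ℤ)) ▸
    SetLike.GradedMul.mul_mem (A := AddMonoidAlgebra.gradeBy ℂ w.toAddMonoidHom) hf hg
  add_mem' := (AddMonoidAlgebra.gradeBy ℂ w.toAddMonoidHom 0).add_mem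
  algebraMap_mem' r :=
    (map_zero w) ▸ AddMonoidAlgebra.single_mem_gradeBy w.toAddMonoidHom (0 : Latt n) r

theorem mono_mem_orthSubalgebra {v : Latt n} (h : w v = 0) : mono v ∈ orthSubalgebra w :=
  have hv : mono v ∈ AddMonoidAlgebra.gradeBy ℂ w.toAddMonoidHom (w v) :=
    AddMonoidAlgebra.single_mem_gradeBy _ _ _
  fun x hx => (hv x hx).trans h

theorem orthSubalgebra_neg (w : DualLatt n) : orthSubalgebra (-w) = orthSubalgebra w :=
  SetLike.ext fun f => forall₂_congr fun v _ => by rw [LinearMap.neg_apply, neg_eq_zero]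

theorem IsMutation.map_of_mem {F f : Laurent n} {μ : BirMap n} (hμ : IsMutation w F μ)
    (hf : f ∈ orthSubalgebra w) : μ (toFun f) = toFun f := by
  rw [eq_sum_smul_mono f]
  simp only [toFun, ← Algebra.algHom_apply ℂ (Laurent n) (FunField n), map_sum, map_smul]
  refine sum_congr rfl fun v hv => congrArg (f.coeff v • ·) ?_
  have h := hμ.map_mono v
  rwa [hf v hv, neg_zero, zpow_zero, mul_one] at h

theorem exists_isMutation {F : Laurent n} (hF0 : F ≠ 0) (hF : F ∈ orthSubalgebra w) :
    ∃ μ : BirMap n, IsMutation w F μ := by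
  have hF0' := toFun_ne_zero hF0
  set p := genericPoint n * cochar (toFun F) hF0' (-w)
  have hpv (v : Latt n) : p v = toFun (mono v) * toFun F ^ (-w v) := rfl
  have hFmem : toFun F ∈ residueField p := by
    rw [← evalAt_genericPoint]
    refine evalAt_mem fun v hv => ?_
    have := apply_mem_residueField p v
    rwa [hpv, hF v hv, neg_zero, zpow_zero, mul_one] at this
  have htop : residueField p = ⊤ := by
    rw [eq_top_iff, ← residueField_genericPoint, residueField_le_iff]
    intro v
    have := mul_mem (apply_mem_residueField p v) (zpow_mem hFmem (w v))
    rwa [hpv, mul_assoc, ← zpow_add₀ hF0', neg_add_cancel, zpow_zero, mul_one] at this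
  obtain ⟨μ, hμ⟩ := exists_birMap htop
  exact ⟨μ, hF0, hF, fun v => (hμ _).trans (evalAt_mono p v)⟩

end mutation

/-! ### The mutations attached to an amenable collection -/

section factor

/-- Evaluation of Laurent polynomials at the unit of the torus. -/
def aug (n : ℕ) : Laurent n →ₐ[ℂ] ℂ := evalAt 1

@[simp]
theorem aug_mono {n : ℕ} (v : Latt n) : aug n (mono v) = 1 := evalAt_mono 1 v

theorem aug_mapDomain {n m : ℕ} (q : Latt n →+ Latt m) (f : Laurent n) :
    aug m (AddMonoidAlgebra.mapDomain q f) = aug n f := evalAt_mapDomain 1 q f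

variable {n c : ℕ} {ι : Type*} [DecidableEq ι] [Fintype ι]
  {Y : SmoothCompleteFan n ι} {L : Fin c → Y.Pic}

/-- The factors `F_i` of the mutations attached to a nef partition, an amenable collection and a
choice of distinguished rays. The exponents are nonnegative, so the truncation `Int.toNat` is
harmless. -/
def factor (P : NefPartition Y L) (u : Fin c → DualLatt n) (s : Fin c → ι) (i : Fin c) :
    Laurent n :=
  ∑ k ∈ P.S i.castSucc, mono (Y.ray k - Y.ray (s i)) *
    ∏ j ∈ (Iio i).attach, factor P u s j ^ (u j (Y.ray k)).toNat
termination_by i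
decreasing_by exact Fin.lt_def.mp (mem_Iio.mp j.2)

variable {P : NefPartition Y L} {u : Fin c → DualLatt n} {s : Fin c → ι}

theorem factor_eq (P : NefPartition Y L) (u : Fin c → DualLatt n) (s : Fin c → ι) (i : Fin c) :
    factor P u s i = ∑ k ∈ P.S i.castSucc, mono (Y.ray k - Y.ray (s i)) *
      ∏ j ∈ Iio i, factor P u s j ^ (u j (Y.ray k)).toNat := by
  rw [factor]
  exact sum_congr rfl fun k _ => congrArg _ <|
    prod_attach (Iio i) fun j => factor P u s j ^ (u j (Y.ray k)).toNat

theorem factor_mem_orthSubalgebra (hu : P.IsAmenable u) (hs : ∀ i, s i ∈ P.S i.castSucc)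
    {i j : Fin c} (hij : i ≤ j) : factor P u s i ∈ orthSubalgebra (u j) := by
  induction i using WellFoundedLT.induction with
  | ind i ih =>
    have hval : ∀ k ∈ P.S i.castSucc, u j (Y.ray k) = u j (Y.ray (s i)) := fun k hk => by
      rcases hij.eq_or_lt with rfl | hij
      · rw [hu.neg_one _ k hk, hu.neg_one _ _ (hs _)]
      · have hij' : i.castSucc < j.castSucc := hij
        rw [hu.zero j _ hij' k hk, hu.zero j _ hij' _ (hs i)]
    rw [factor_eq]
    refine sum_mem fun k hk => mul_mem (mono_mem_orthSubalgebra ?_) (prod_mem fun l hl => ?_)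
    · rw [map_sub, hval k hk, sub_self]
    · exact pow_mem (ih l (mem_Iio.mp hl) ((mem_Iio.mp hl).le.trans hij)) _

open ComplexOrder in
theorem aug_factor_pos (hs : ∀ i, s i ∈ P.S i.castSucc) (i : Fin c) :
    0 < aug n (factor P u s i) := by
  induction i using WellFoundedLT.induction with
  | ind i ih =>
    rw [factor_eq, map_sum]
    refine sum_pos (fun k _ => ?_) ⟨s i, hs i⟩
    rw [map_mul, aug_mono, one_mul, map_prod]
    exact prod_pos fun j hj => by
      rw [map_pow]
      exact pow_pos (ih j (mem_Iio.mp hj)) _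

open ComplexOrder in
theorem factor_ne_zero (hs : ∀ i, s i ∈ P.S i.castSucc) (i : Fin c) : factor P u s i ≠ 0 :=
  fun h => (aug_factor_pos (u := u) hs i).ne' (by rw [h, map_zero])

/-- The pull-back of the superpotential along all mutations. -/
def totalPull (P : NefPartition Y L) (u : Fin c → DualLatt n) (s : Fin c → ι) : Laurent n :=
  ∑ i, mono (Y.ray (s i)) + ∑ k ∈ P.S (Fin.last c), mono (Y.ray k) *
    ∏ j, factor P u s j ^ (u j (Y.ray k)).toNat

variable {K : Type*} [Field K]

theorem prod_zpow_of_mem_S (hu : P.IsAmenable u) (φ : Fin c → K) {i : Fin c} {k : ι}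
    (hk : k ∈ P.S i.castSucc) :
    ∏ j, φ j ^ u j (Y.ray k) = (φ i)⁻¹ * ∏ j ∈ Iio i, φ j ^ u j (Y.ray k) := by
  have hsub : insert i (Iio i) ⊆ univ := subset_univ _
  rw [← prod_subset hsub fun j _ hj => ?_, prod_insert (by simp), hu.neg_one i k hk, zpow_neg_one]
  have hij : i.castSucc < j.castSucc := by
    simp only [mem_insert, mem_Iio, not_or, not_lt] at hj
    exact lt_of_le_of_ne hj.2 fun h => hj.1 (Fin.castSucc_injective _ h.symm)
  rw [hu.zero j i.castSucc hij k hk, zpow_zero]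

variable [Algebra ℂ K]

theorem mul_evalAt_factor (hu : P.IsAmenable u) (r : AddChar (Latt n) K) (i : Fin c) :
    r (Y.ray (s i)) * evalAt r (factor P u s i)
      = ∑ k ∈ P.S i.castSucc, r (Y.ray k) *
        ∏ j ∈ Iio i, evalAt r (factor P u s j) ^ u j (Y.ray k) := by
  rw [factor_eq, map_sum, mul_sum]
  refine sum_congr rfl fun k hk => ?_
  rw [map_mul, evalAt_mono, ← mul_assoc, ← r.map_add_eq_mul, add_sub_cancel, map_prod]
  refine congrArg _ (prod_congr rfl fun j hj => ?_)
  rw [map_pow, ← zpow_natCast,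
    Int.toNat_of_nonneg (hu.nonneg j _ (Fin.castSucc_lt_castSucc_iff.mpr (mem_Iio.mp hj)) k hk)]

theorem mul_evalAt_factor_eq_mul_sum (hu : P.IsAmenable u) {p r : AddChar (Latt n) K}
    {φ : Fin c → K} (hp : ∀ v, p v = r v * ∏ j, φ j ^ u j v) {i : Fin c} (hφ : φ i ≠ 0)
    (h : ∀ j < i, φ j = evalAt r (factor P u s j)) :
    r (Y.ray (s i)) * evalAt r (factor P u s i) = φ i * ∑ k ∈ P.S i.castSucc, p (Y.ray k) := by
  rw [mul_evalAt_factor hu, mul_sum]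
  refine sum_congr rfl fun k hk => ?_
  rw [hp, prod_zpow_of_mem_S hu φ hk, mul_left_comm (φ i), mul_inv_cancel_left₀ hφ]
  exact congrArg _ (prod_congr rfl fun j hj => by rw [h j (mem_Iio.mp hj)])

theorem evalAt_totalPull (hu : P.IsAmenable u) {p r : AddChar (Latt n) K}
    (h0 : ∀ j, evalAt r (factor P u s j) ≠ 0)
    (hp : ∀ v, p v = r v * ∏ j, evalAt r (factor P u s j) ^ u j v) :
    evalAt r (totalPull P u s) = ∑ k, p (Y.ray k) := by
  rw [← sum_fiberwise univ P.part, Fin.sum_univ_castSucc, totalPull, map_add, map_sum, map_sum]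
  congr 1
  · refine sum_congr rfl fun i _ => mul_left_cancel₀ (h0 i) ?_
    rw [evalAt_mono, mul_comm]
    exact mul_evalAt_factor_eq_mul_sum hu hp (h0 i) fun j _ => rfl
  · refine sum_congr rfl fun k hk => ?_
    rw [map_mul, evalAt_mono, map_prod, hp]
    refine congrArg _ (prod_congr rfl fun j _ => ?_)
    rw [map_pow, ← zpow_natCast,
      Int.toNat_of_nonneg (hu.nonneg j (Fin.last c) (Fin.castSucc_lt_last j) k hk)]

end factor

section iterPull

variable {n c : ℕ}

theorem iterPull_succ (μ : Fin c → BirMap n) (i : Fin c) (x : FunField n) :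
    iterPull μ i.succ x = μ i (iterPull μ i.castSucc x) := by
  rw [iterPull, Fin.induction_succ]
  rfl

theorem iterPull_mono {u : Fin c → DualLatt n} {F : Fin c → Laurent n} {μ : Fin c → BirMap n}
    (hμ : ∀ i, IsMutation (-u i) (F i) (μ i)) (v : Latt n) {j : Fin (c + 1)}
    (hF : ∀ i i', i < i' → i'.castSucc < j → F i ∈ orthSubalgebra (u i')) :
    iterPull μ j (toFun (mono v))
      = toFun (mono v) * ∏ i with i.castSucc < j, toFun (F i) ^ u i v := by
  induction j using Fin.induction with
  | zero => simp [iterPull]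
  | succ k ih =>
    have hset : ({i | i.castSucc < k.succ} : Finset (Fin c))
        = insert k ({i | i.castSucc < k.castSucc} : Finset (Fin c)) := by
      ext i
      simp [Fin.castSucc_lt_succ_iff, le_iff_eq_or_lt]
    rw [iterPull_succ, ih fun i i' h h' => hF i i' h (h'.trans Fin.castSucc_lt_succ), map_mul,
      (hμ k).map_mono, map_prod, hset, prod_insert (by simp), mul_assoc, LinearMap.neg_apply,
      neg_neg]
    refine congrArg _ (congrArg _ (prod_congr rfl fun i hi => ?_))
    have hik : i < k := by simpa using hi
    rw [map_zpow₀, (hμ k).map_of_mem]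
    rw [orthSubalgebra_neg]
    exact hF i k hik Fin.castSucc_lt_succ

variable {ι : Type*} [DecidableEq ι] [Fintype ι] {Y : SmoothCompleteFan n ι} {L : Fin c → Y.Pic}
  {P : NefPartition Y L} {u : Fin c → DualLatt n} {s : Fin c → ι} {μ : Fin c → BirMap n}

theorem iterPull_G {F : Fin c → Laurent n} (hu : P.IsAmenable u)
    (hs : ∀ i, s i ∈ P.S i.castSucc)
    (hμ : ∀ i, IsMutation (-u i) (F i) (μ i)) (i : Fin c) (hF : ∀ j < i, F j = factor P u s j) :
    iterPull μ i.castSucc (toFun (P.G i.castSucc))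
      = toFun (mono (Y.ray (s i)) * factor P u s i) := by
  have h := mul_evalAt_factor (s := s) hu (genericPoint n) i
  simp only [evalAt_genericPoint, genericPoint_apply] at h
  rw [NefPartition.G, toFun, toFun, map_mul, h, map_sum, map_sum]
  refine sum_congr rfl fun k _ => ?_
  rw [iterPull_mono hμ]
  · refine congrArg _ (prod_congr (by ext; simp) fun j hj => ?_)
    rw [hF j (mem_Iio.mp hj)]
  · intro j j' hj hj'
    rw [hF j (hj.trans hj')]
    exact factor_mem_orthSubalgebra hu hs hj.le

theorem iterPull_superpotential (hu : P.IsAmenable u) (hs : ∀ i, s i ∈ P.S i.castSucc)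
    (hμ : ∀ i, IsMutation (-u i) (factor P u s i) (μ i)) :
    iterPull μ (Fin.last c) (toFun (superpotential Y)) = toFun (totalPull P u s) := by
  have h0 (i) := toFun_ne_zero (factor_ne_zero (u := u) hs i)
  have h := evalAt_totalPull (s := s) hu
    (p := genericPoint n * ∏ j, cochar (toFun (factor P u s j)) (h0 j) (u j))
    (r := genericPoint n) (fun j => evalAt_genericPoint (factor P u s j) ▸ h0 j) fun v => by
      simp only [AddChar.mul_apply, AddChar.prod_apply, cochar_apply, evalAt_genericPoint]
  rw [evalAt_genericPoint] at h
  rw [h, superpotential, toFun, map_sum, map_sum]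
  refine sum_congr rfl fun k _ => ?_
  rw [iterPull_mono hμ _ fun i i' hi _ => factor_mem_orthSubalgebra hu hs hi.le,
    filter_true_of_mem fun i _ => Fin.castSucc_lt_last i]
  simp only [AddChar.mul_apply, AddChar.prod_apply, cochar_apply, genericPoint_apply]

theorem IsLaurentMirror.exists_eq_mapDomain {f : Laurent (n - c)} (hu : P.IsAmenable u)
    (hs : ∀ i, s i ∈ P.S i.castSucc) (hf : IsLaurentMirror P u s f) :
    ∃ q : Latt n →+ Latt (n - c), Function.Surjective q ∧
      q.ker = AddSubgroup.closure (Set.range fun i => Y.ray (s i)) ∧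
      f = AddMonoidAlgebra.mapDomain q (totalPull P u s) := by
  obtain ⟨F, μ, H, q, hμ, hF, hH, hq, hker, rfl⟩ := hf
  have hFeq (i) : F i = factor P u s i := by
    induction i using WellFoundedLT.induction with
    | ind i ih =>
      exact mono_mul_right_injective _
        (toFun_injective ((hF i).trans (iterPull_G hu hs hμ i ih)))
  obtain rfl : F = factor P u s := funext hFeq
  obtain rfl := toFun_injective (hH.trans (iterPull_superpotential hu hs hμ))
  exact ⟨q, hq, hker, rfl⟩

theorem exists_isLaurentMirror (hu : P.IsAmenable u) (hs : ∀ i, s i ∈ P.S i.castSucc)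
    {q : Latt n →+ Latt (n - c)} (hq : Function.Surjective q)
    (hker : q.ker = AddSubgroup.closure (Set.range fun i => Y.ray (s i))) :
    ∃ f, IsLaurentMirror P u s f := by
  choose μ hμ using fun i => exists_isMutation (w := -u i) (factor_ne_zero (u := u) hs i)
    ((orthSubalgebra_neg _).symm ▸ factor_mem_orthSubalgebra hu hs le_rfl)
  exact ⟨_, factor P u s, μ, totalPull P u s, q, hμ,
    fun i => (iterPull_G hu hs hμ i fun _ _ => rfl).symm,
    (iterPull_superpotential hu hs hμ).symm, hq, hker, rfl⟩

end iterPull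

/-! ### The splitting of the lattice defined by an amenable collection -/

section splitting

theorem isCompl_ker_range {R E F G : Type*} [Ring R] [AddCommGroup E] [AddCommGroup F]
    [AddCommGroup G] [Module R E] [Module R F] [Module R G] {f : E →ₗ[R] F} {g : G →ₗ[R] E}
    (h : Function.Bijective (f ∘ₗ g)) : IsCompl (LinearMap.ker f) (LinearMap.range g) := by
  refine ⟨Submodule.disjoint_def.mpr ?_, Submodule.codisjoint_iff_exists_add_eq.mpr fun x => ?_⟩
  · rintro _ hx ⟨y, rfl⟩
    rw [h.1 ((LinearMap.mem_ker.mp hx).trans (map_zero (f ∘ₗ g)).symm), map_zero]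
  · obtain ⟨y, hy⟩ := h.2 (f x)
    refine ⟨x - g y, g y, ?_, ⟨y, rfl⟩, sub_add_cancel _ _⟩
    rw [LinearMap.mem_ker, map_sub, sub_eq_zero, ← hy, LinearMap.comp_apply]

variable {n m c : ℕ}

/-- An identification of `N` with `ℤᶜ × ℤᵐ` whose components are the linear forms `u_i` and the
homomorphism `q`. -/
structure Splitting (u : Fin c → DualLatt n) (q : Latt n →+ Latt m) where
  /-- the isomorphism `v ↦ ((⟨u_i, v⟩)_i, q v)` -/
  equiv : Latt n ≃ₗ[ℤ] (Fin c → ℤ) × Latt m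
  equiv_apply : ∀ v, equiv v = (fun i => u i v, q v)

namespace Splitting

variable {u : Fin c → DualLatt n} {q : Latt n →+ Latt m} (σ : Splitting u q)

/-- The section of `q` with values in `⋂ u_i^⊥`. -/
def incl : Latt m →+ Latt n :=
  (σ.equiv.symm.toLinearMap ∘ₗ LinearMap.inr ℤ (Fin c → ℤ) (Latt m)).toAddMonoidHom

/-- The basis of `ker q` dual to the `u_i`. -/
def dualVec (i : Fin c) : Latt n := σ.equiv.symm (Pi.single i 1, 0)

theorem equiv_incl (w : Latt m) : σ.equiv (σ.incl w) = (0, w) := σ.equiv.apply_symm_apply _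

theorem apply_incl (i : Fin c) (w : Latt m) : u i (σ.incl w) = 0 :=
  congrFun (congrArg Prod.fst ((σ.equiv_apply _).symm.trans (σ.equiv_incl w))) i

theorem proj_incl (w : Latt m) : q (σ.incl w) = w :=
  congrArg Prod.snd ((σ.equiv_apply _).symm.trans (σ.equiv_incl w))

theorem eq_incl_add_sum (v : Latt n) : v = σ.incl (q v) + ∑ i, u i v • σ.dualVec i := by
  apply σ.equiv.injective
  rw [map_add, equiv_incl, σ.equiv_apply v, map_sum]
  simp only [map_smul, dualVec, LinearEquiv.apply_symm_apply]
  ext i <;> simp [Prod.fst_sum, Prod.snd_sum, Pi.single_apply]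

theorem addChar_apply {K : Type*} [Field K] (p : AddChar (Latt n) K) (v : Latt n) :
    p v = p (σ.incl (q v)) * ∏ i, p (σ.dualVec i) ^ u i v := by
  conv_lhs => rw [σ.eq_incl_add_sum v]
  simp only [AddChar.map_add_eq_mul, addChar_map_sum, AddChar.map_zsmul_eq_zpow]

end Splitting

variable {ι : Type*} [DecidableEq ι] [Fintype ι] {Y : SmoothCompleteFan n ι} {L : Fin c → Y.Pic}
  {P : NefPartition Y L} {u : Fin c → DualLatt n} {s : Fin c → ι}

theorem isUnit_det_pairing (hu : P.IsAmenable u) (hs : ∀ i, s i ∈ P.S i.castSucc) :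
    IsUnit (Matrix.of fun i j => u i (Y.ray (s j))).det := by
  rw [Matrix.det_of_isUpperTriangular]
  · simp only [Matrix.of_apply, fun i => hu.neg_one i _ (hs i), prod_const]
    exact isUnit_one.neg.pow _
  · intro i j hij
    exact hu.zero i j.castSucc (Fin.castSucc_lt_castSucc_iff.mpr hij) _ (hs j)

theorem bijective_pairing (hu : P.IsAmenable u) (hs : ∀ i, s i ∈ P.S i.castSucc) :
    Function.Bijective
      (LinearMap.pi u ∘ₗ Fintype.linearCombination ℤ fun i => Y.ray (s i)) := by
  have h : LinearMap.pi u ∘ₗ Fintype.linearCombination ℤ (fun i => Y.ray (s i))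
      = Matrix.toLin' (Matrix.of fun i j => u i (Y.ray (s j))) := by
    ext j i
    simp [Fintype.linearCombination_apply, Pi.single_apply, -zsmul_eq_mul]
  rw [h, ← Module.End.isUnit_iff, LinearMap.isUnit_iff_isUnit_det, LinearMap.det_toLin']
  exact isUnit_det_pairing hu hs

theorem isCompl_ker_closure (hu : P.IsAmenable u) (hs : ∀ i, s i ∈ P.S i.castSucc) :
    IsCompl (LinearMap.ker (LinearMap.pi u))
      (AddSubgroup.closure (Set.range fun i => Y.ray (s i))).toIntSubmodule := by
  rw [← Submodule.span_int_eq_addSubgroupClosure, ← Fintype.range_linearCombination]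
  exact isCompl_ker_range (bijective_pairing hu hs)

theorem surjective_pi_of_isAmenable (hu : P.IsAmenable u) (hs : ∀ i, s i ∈ P.S i.castSucc) :
    Function.Surjective (LinearMap.pi u) :=
  Function.Surjective.of_comp (bijective_pairing hu hs).2

/-- The splitting of `N` defined by an amenable collection and coordinates on the quotient by the
distinguished rays. -/
def splitting (hu : P.IsAmenable u) (hs : ∀ i, s i ∈ P.S i.castSucc) {q : Latt n →+ Latt m}
    (hq : Function.Surjective q)
    (hker : q.ker = AddSubgroup.closure (Set.range fun i => Y.ray (s i))) : Splitting u q where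
  equiv := (LinearMap.pi u).equivProdOfSurjectiveOfIsCompl q.toIntLinearMap
    (LinearMap.range_eq_top.mpr (surjective_pi_of_isAmenable hu hs))
    (LinearMap.range_eq_top.mpr hq)
    (by
      have h : LinearMap.ker q.toIntLinearMap = _ := congrArg AddSubgroup.toIntSubmodule hker
      exact h ▸ isCompl_ker_closure hu hs)
  equiv_apply _ := rfl

theorem exists_quotient_coordinates (hu : P.IsAmenable u) (hs : ∀ i, s i ∈ P.S i.castSucc) :
    c ≤ n ∧ ∃ q : Latt n →+ Latt (n - c), Function.Surjective q ∧
      q.ker = AddSubgroup.closure (Set.range fun i => Y.ray (s i)) := by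
  have hrank := Submodule.finrank_quotient_add_finrank (LinearMap.ker (LinearMap.pi u))
  rw [((LinearMap.pi u).quotKerEquivOfSurjective (surjective_pi_of_isAmenable hu hs)).finrank_eq,
    Module.finrank_fin_fun, Module.finrank_fin_fun] at hrank
  have hc := isCompl_ker_closure hu hs
  let e : LinearMap.ker (LinearMap.pi u) ≃ₗ[ℤ] Latt (n - c) :=
    LinearEquiv.ofFinrankEq _ _ (by rw [Module.finrank_fin_fun]; omega)
  let q := e.toLinearMap ∘ₗ Submodule.projectionOnto _ _ hc
  refine ⟨by omega, q.toAddMonoidHom,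
    e.surjective.comp (Submodule.projectionOnto_surjective hc), ?_⟩
  have hker : LinearMap.ker q = _ := (e.ker_comp _).trans (Submodule.ker_projectionOnto hc)
  exact congrArg Submodule.toAddSubgroup hker

end splitting

/-! ### Rational functions that are regular and positive at the unit of the torus -/

section posAtOne

/-- The ring of the Laurent polynomials `f` whose value `t` at the unit of the torus is real,
encoded as the ring of the pairs `(f, t)`. -/
def realPoly (m : ℕ) : Subring (Laurent m × ℝ) :=
  RingHom.eqLocus ((aug m).toRingHom.comp (RingHom.fst _ _))
    (Complex.ofRealHom.comp (RingHom.snd _ _))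

/-- Evaluation at the unit of the torus. -/
def evalPoly (m : ℕ) : realPoly m →+* ℝ := (RingHom.snd _ _).comp (realPoly m).subtype

instance (m : ℕ) : (RingHom.ker (evalPoly m)).IsPrime := RingHom.ker_isPrime _

/-- The local ring, at the unit of the torus, of the rational functions with a real value there. -/
abbrev LocalRingAtOne (m : ℕ) := Localization.AtPrime (RingHom.ker (evalPoly m))

variable {m : ℕ}

theorem toFun_ne_zero_of_primeCompl (y : (RingHom.ker (evalPoly m)).primeCompl) :
    toFun y.1.1.1 ≠ 0 := by
  refine toFun_ne_zero fun h => y.2 (Complex.ofReal_injective ?_)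
  have hy : aug m y.1.1.1 = (evalPoly m y : ℂ) := y.1.2
  rw [← hy, h, map_zero, Complex.ofReal_zero]

/-- The extension of `evalPoly` to the local ring. -/
def evalOne (m : ℕ) : LocalRingAtOne m →+* ℝ :=
  IsLocalization.lift (M := (RingHom.ker (evalPoly m)).primeCompl) (g := evalPoly m)
    fun y => isUnit_iff_ne_zero.mpr y.2

/-- The elements of the local ring as rational functions. -/
def toRat (m : ℕ) : LocalRingAtOne m →+* FunField m :=
  IsLocalization.lift (M := (RingHom.ker (evalPoly m)).primeCompl)
    (g := (algebraMap (Laurent m) (FunField m)).comp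
      ((RingHom.fst _ _).comp (realPoly m).subtype))
    fun y => isUnit_iff_ne_zero.mpr (toFun_ne_zero_of_primeCompl y)

instance (m : ℕ) : IsLocalHom (evalOne m) where
  map_nonunit x hx := by
    obtain ⟨a, s, rfl⟩ := IsLocalization.exists_mk'_eq (RingHom.ker (evalPoly m)).primeCompl x
    rw [IsLocalization.AtPrime.isUnit_mk'_iff]
    intro ha
    rw [evalOne, IsLocalization.lift_mk', (RingHom.mem_ker).mp ha, zero_mul] at hx
    exact not_isUnit_zero hx

/-- The rational functions that are regular at the unit of the torus with a positive value there. -/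
def posAtOne (m : ℕ) : Submonoid (FunField m) :=
  ((Submonoid.pos ℝ).comap (evalOne m)).map (toRat m)

theorem mem_posAtOne {x : FunField m} : x ∈ posAtOne m ↔ ∃ r, 0 < evalOne m r ∧ toRat m r = x :=
  Iff.rfl

open ComplexOrder in
theorem toFun_mem_posAtOne {f : Laurent m} (hf : 0 < aug m f) : toFun f ∈ posAtOne m := by
  obtain ⟨hpos, him⟩ := Complex.pos_iff.mp hf
  let a : realPoly m := ⟨(f, (aug m f).re), Complex.ext rfl him.symm⟩
  refine ⟨algebraMap _ _ a, ?_, by simp [toRat, a]⟩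
  change 0 < evalOne m (algebraMap _ _ a)
  rwa [evalOne, IsLocalization.lift_eq]

open ComplexOrder in
theorem toFun_mono_mem_posAtOne (v : Latt m) : toFun (mono v) ∈ posAtOne m :=
  toFun_mem_posAtOne (by rw [aug_mono]; exact one_pos)

theorem exists_unit_of_mem_posAtOne {x : FunField m} (hx : x ∈ posAtOne m) :
    ∃ r : (LocalRingAtOne m)ˣ, 0 < evalOne m r ∧ toRat m r = x := by
  obtain ⟨r, hr, rfl⟩ := mem_posAtOne.mp hx
  obtain ⟨r, rfl⟩ := isUnit_of_map_unit (evalOne m) r (isUnit_iff_ne_zero.mpr hr.ne')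
  exact ⟨r, hr, rfl⟩

theorem ne_zero_of_mem_posAtOne {x : FunField m} (hx : x ∈ posAtOne m) : x ≠ 0 := by
  obtain ⟨r, -, rfl⟩ := exists_unit_of_mem_posAtOne hx
  exact (r.isUnit.map (toRat m)).ne_zero

theorem inv_mem_posAtOne {x : FunField m} (hx : x ∈ posAtOne m) : x⁻¹ ∈ posAtOne m := by
  obtain ⟨r, hr, rfl⟩ := exists_unit_of_mem_posAtOne hx
  refine mem_posAtOne.mpr ⟨(r⁻¹ : (LocalRingAtOne m)ˣ), ?_, map_units_inv (toRat m) r⟩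
  rw [map_units_inv]
  exact inv_pos.mpr hr

theorem zpow_mem_posAtOne {x : FunField m} (hx : x ∈ posAtOne m) (k : ℤ) : x ^ k ∈ posAtOne m := by
  obtain ⟨k, rfl | rfl⟩ := k.eq_nat_or_neg
  · simpa using pow_mem hx k
  · simpa using inv_mem_posAtOne (pow_mem hx k)

end posAtOne

/-! ### The torus chart of the locus `G_1 = ⋯ = G_c = 1` -/

section chart

variable {n m c : ℕ} {ι : Type*} [DecidableEq ι] [Fintype ι]
  {Y : SmoothCompleteFan n ι} {L : Fin c → Y.Pic}

/-- The point `p` of the torus lies on the locus `G_1 = ⋯ = G_c = 1` of a nef partition. -/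
def OnLocus {K : Type*} [Field K] (P : NefPartition Y L) (p : AddChar (Latt n) K) : Prop :=
  ∀ i : Fin c, ∑ k ∈ P.S i.castSucc, p (Y.ray k) = 1

variable {P : NefPartition Y L} {u : Fin c → DualLatt n} {s : Fin c → ι} {q : Latt n →+ Latt m}
  (σ : Splitting u q) {K : Type*} [Field K] [Algebra ℂ K] {p : AddChar (Latt n) K}

theorem Splitting.apply_dualVec (hu : P.IsAmenable u) (hqs : ∀ i, q (Y.ray (s i)) = 0)
    (hp : OnLocus P p) (i : Fin c) :
    p (σ.dualVec i)
      = evalAt ((p.compAddMonoidHom σ.incl).compAddMonoidHom q) (factor P u s i) := by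
  induction i using WellFoundedLT.induction with
  | ind i ih =>
    have h := mul_evalAt_factor_eq_mul_sum (s := s) (φ := fun i => p (σ.dualVec i)) hu
      (r := (p.compAddMonoidHom σ.incl).compAddMonoidHom q) (σ.addChar_apply p)
      (addChar_ne_zero p _) ih
    rw [hp i, mul_one, AddChar.compAddMonoidHom_apply, hqs, AddChar.map_zero_eq_one, one_mul] at h
    exact h.symm

theorem Splitting.addChar_apply_of_onLocus (hu : P.IsAmenable u)
    (hqs : ∀ i, q (Y.ray (s i)) = 0) (hp : OnLocus P p) (v : Latt n) :
    p v = p (σ.incl (q v)) *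
      ∏ i, evalAt ((p.compAddMonoidHom σ.incl).compAddMonoidHom q) (factor P u s i) ^ u i v := by
  simp only [← σ.apply_dualVec hu hqs hp]
  exact σ.addChar_apply p v

theorem Splitting.apply_mem_residueField (hu : P.IsAmenable u) (hqs : ∀ i, q (Y.ray (s i)) = 0)
    (hp : OnLocus P p) (v : Latt n) : p v ∈ residueField (p.compAddMonoidHom σ.incl) := by
  have hmem (w) : p (σ.incl w) ∈ residueField (p.compAddMonoidHom σ.incl) :=
    ToricLG.apply_mem_residueField (p.compAddMonoidHom σ.incl) w
  rw [σ.addChar_apply_of_onLocus hu hqs hp v]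
  exact mul_mem (hmem _) (prod_mem fun i _ => zpow_mem (evalAt_mem fun v _ => hmem _) _)

theorem Splitting.evalAt_mirror (hu : P.IsAmenable u) (hqs : ∀ i, q (Y.ray (s i)) = 0)
    (hp : OnLocus P p) :
    evalAt (p.compAddMonoidHom σ.incl) (AddMonoidAlgebra.mapDomain q (totalPull P u s))
      = ∑ k, p (Y.ray k) := by
  rw [evalAt_mapDomain]
  refine evalAt_totalPull hu (fun i => ?_) (σ.addChar_apply_of_onLocus hu hqs hp)
  rw [← σ.apply_dualVec hu hqs hp]
  exact addChar_ne_zero p _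

theorem Splitting.exists_generic_point_of_locus (hu : P.IsAmenable u)
    (hs : ∀ i, s i ∈ P.S i.castSucc) (hqs : ∀ i, q (Y.ray (s i)) = 0) :
    ∃ p : AddChar (Latt n) (FunField m), p.compAddMonoidHom σ.incl = genericPoint m ∧
      OnLocus P p ∧ ∀ v, p v ∈ posAtOne m := by
  set r := (genericPoint m).compAddMonoidHom q with hr
  have hφ (i) : evalAt r (factor P u s i)
      = toFun (AddMonoidAlgebra.mapDomain q (factor P u s i)) := by
    rw [← evalAt_genericPoint, evalAt_mapDomain]
  have hpos (i) : evalAt r (factor P u s i) ∈ posAtOne m := by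
    rw [hφ]
    exact toFun_mem_posAtOne (aug_mapDomain q _ ▸ aug_factor_pos hs i)
  have h0 (i) := ne_zero_of_mem_posAtOne (hpos i)
  obtain ⟨p, hp⟩ : ∃ p : AddChar (Latt n) (FunField m),
      ∀ v, p v = r v * ∏ i, evalAt r (factor P u s i) ^ u i v :=
    ⟨r * ∏ i, cochar _ (h0 i) (u i), fun v => by
      simp only [AddChar.mul_apply, AddChar.prod_apply, cochar_apply]⟩
  refine ⟨p, ?_, fun i => ?_, fun v => ?_⟩
  · ext w
    simp only [AddChar.compAddMonoidHom_apply, hp, σ.apply_incl, zpow_zero, prod_const_one,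
      mul_one, hr, σ.proj_incl]
  · have h := mul_evalAt_factor_eq_mul_sum (s := s) hu hp (h0 i) fun _ _ => rfl
    rw [hr, AddChar.compAddMonoidHom_apply, hqs, AddChar.map_zero_eq_one, one_mul, ← hr] at h
    exact mul_left_cancel₀ (h0 i) (h.symm.trans (mul_one _).symm)
  · rw [hp]
    exact mul_mem (toFun_mono_mem_posAtOne _) (prod_mem fun i _ => zpow_mem_posAtOne (hpos i) _)

end chart

/-! ### Laplacians of weighted digraphs -/

section digraph

variable {ι J : Type*} {src tgt : ι → J} {root : J → J}

/-- The relation that there is an edge from `a` to `b` in the digraph on `J` with an edge from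
`src j` to `tgt j` for each `j`. -/
def Edge (src tgt : ι → J) (a b : J) : Prop := ∃ j, src j = a ∧ tgt j = b

/-- The map `root` chooses a vertex in each connected component of the digraph, and every component
is strongly connected. -/
structure IsRoot (src tgt : ι → J) (root : J → J) : Prop where
  idem : ∀ a, root (root a) = root a
  root_eq : ∀ j, root (src j) = root (tgt j)
  to_root : ∀ a, Relation.ReflTransGen (Edge src tgt) a (root a)
  from_root : ∀ a, Relation.ReflTransGen (Edge src tgt) (root a) a

theorem edge_swap : Function.swap (Edge src tgt) = Edge tgt src := by
  ext a b
  exact exists_congr fun j => and_comm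

theorem IsRoot.symm (h : IsRoot src tgt root) : IsRoot tgt src root where
  idem := h.idem
  root_eq j := (h.root_eq j).symm
  to_root a := edge_swap (src := src) ▸ (h.from_root a).swap
  from_root a := edge_swap (src := src) ▸ (h.to_root a).swap

variable [Fintype ι] [Finite J] [DecidableEq J]

theorem Edge.reflTransGen_swap {x : ι → ℝ} (hx : ∀ j, 0 < x j)
    (hbal : ∀ a, ∑ j with src j = a, x j = ∑ j with tgt j = a, x j) {a b : J}
    (h : Edge src tgt a b) : Relation.ReflTransGen (Edge src tgt) b a := by
  classical
  cases nonempty_fintype J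
  obtain ⟨j₀, rfl, rfl⟩ := h
  -- The set of vertices that can be reached from `tgt j₀` has no outflow, hence no inflow.
  let Z : Finset J := {z | Relation.ReflTransGen (Edge src tgt) (tgt j₀) z}
  have mem_Z (z) : z ∈ Z ↔ Relation.ReflTransGen (Edge src tgt) (tgt j₀) z := by simp [Z]
  have hflow : ∑ j with src j ∈ Z, x j = ∑ j with tgt j ∈ Z, x j := by
    rw [← sum_fiberwise_eq_sum_filter, ← sum_fiberwise_eq_sum_filter]
    exact sum_congr rfl fun a _ => hbal a
  have hsub : ({j | src j ∈ Z} : Finset ι) ⊆ ({j | tgt j ∈ Z} : Finset ι) :=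
    monotone_filter_right _ fun j _ hj => (mem_Z _).2 (((mem_Z _).1 hj).tail ⟨j, rfl, rfl⟩)
  have hj₀ : j₀ ∈ ({j | src j ∈ Z} : Finset ι) := by
    by_contra h
    exact hflow.not_lt (sum_lt_sum_of_subset hsub (by simp [mem_Z, Relation.ReflTransGen.refl]) h
      (hx _) fun j _ _ => (hx j).le)
  exact (mem_Z _).1 (mem_filter.1 hj₀).2

theorem exists_isRoot {x : ι → ℝ} (hx : ∀ j, 0 < x j)
    (hbal : ∀ a, ∑ j with src j = a, x j = ∑ j with tgt j = a, x j) :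
    ∃ root, IsRoot src tgt root := by
  have hsymm {a b} (h : Relation.ReflTransGen (Edge src tgt) a b) :
      Relation.ReflTransGen (Edge src tgt) b a := by
    induction h with
    | refl => exact .refl
    | tail _ h ih => exact (h.reflTransGen_swap hx hbal).trans ih
  let S : Setoid J := ⟨Relation.ReflTransGen (Edge src tgt), fun _ => .refl, hsymm, .trans⟩
  have hout (a) : Relation.ReflTransGen (Edge src tgt) (Quotient.out (Quotient.mk S a)) a :=
    Quotient.mk_out (s := S) a
  exact ⟨fun a => Quotient.out (Quotient.mk S a), fun a => by rw [Quotient.out_eq],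
    fun j => congrArg _ (Quotient.sound (s := S) (.single ⟨j, rfl, rfl⟩)),
    fun a => hsymm (hout a), hout⟩

end digraph

section laplacian

variable {ι J : Type*} [Fintype ι] [DecidableEq J]

/-- The Laplace operator of the digraph with edge weights `x`, acting on functions on the
vertices. Its columns sum to zero. -/
def lapl {R V : Type*} [CommRing R] [AddCommGroup V] [Module R V] (src tgt : ι → J) (x : ι → R)
    (z : J → V) (a : J) : V :=
  (∑ j with tgt j = a, x j) • z a - ∑ j with src j = a, x j • z (tgt j)

/-- The matrix of the Laplace operator. -/
def lapMat {R : Type*} [CommRing R] (src tgt : ι → J) (x : ι → R) : Matrix J J R :=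
  Matrix.of fun a b => (if a = b then ∑ j with tgt j = a, x j else 0)
    - ∑ j with src j = a ∧ tgt j = b, x j

/-- The matrix of the Dirichlet problem: to find a function with given values at the roots and
given Laplacian elsewhere. -/
def dirichletMat {R : Type*} [CommRing R] (src tgt : ι → J) (root : J → J) (x : ι → R) :
    Matrix J J R :=
  Matrix.of fun a b => if root a = a then (1 : Matrix J J R) a b else lapMat src tgt x a b

/-- The stationary vectors of the digraph, normalised to be `1` at the roots. -/
structure IsStationary {R : Type*} [CommRing R] (src tgt : ι → J) (root : J → J) (x : ι → R)
    (B : J → R) : Prop where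
  eq_one : ∀ a, root a = a → B a = 1
  lapl_eq_zero : ∀ a, lapl src tgt x B a = 0

variable {src tgt : ι → J} {root : J → J} {R : Type*} [CommRing R]

section module

variable {V : Type*} [AddCommGroup V] [Module R V] {x : ι → R}

theorem lapl_eq_sum_sub_sum (z : J → V) (a : J) :
    lapl src tgt x z a
      = ∑ j with tgt j = a, x j • z (tgt j) - ∑ j with src j = a, x j • z (tgt j) := by
  rw [lapl, sum_smul]
  exact congrArg (· - _) (sum_congr rfl fun j hj => by rw [(mem_filter.1 hj).2])

theorem lapl_sub (z z' : J → V) (a : J) :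
    lapl src tgt x (z - z') a = lapl src tgt x z a - lapl src tgt x z' a := by
  simp only [lapl, Pi.sub_apply, smul_sub, sum_sub_distrib]
  abel

theorem map_lapl {V' : Type*} [AddCommGroup V'] [Module R V'] (f : V →ₗ[R] V') (z : J → V)
    (a : J) : f (lapl src tgt x z a) = lapl src tgt x (fun b => f (z b)) a := by
  simp [lapl, map_sum]

variable [Fintype J]

theorem sum_class_sum_fiber {f : ι → J} (y : ι → V) (r : J) :
    ∑ a with root a = r, ∑ j with f j = a, y j = ∑ j with root (f j) = r, y j := by
  rw [sum_fiberwise_eq_sum_filter]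
  simp

theorem sum_class_lapl (hr : IsRoot src tgt root) (z : J → V) (r : J) :
    ∑ a with root a = r, lapl src tgt x z a = 0 := by
  simp only [lapl_eq_sum_sub_sum, sum_sub_distrib, sum_class_sum_fiber, hr.root_eq, sub_self]

theorem eq_zero_of_sum_class_eq_zero {w : J → V} (hw : ∀ a, root a ≠ a → w a = 0)
    (hsum : ∀ r, ∑ a with root a = r, w a = 0) (a : J) : w a = 0 := by
  by_cases ha : root a = a
  · rw [← hsum a, eq_comm]
    refine sum_eq_single a (fun b hb hba => hw b fun h => hba ?_) (by simp [ha])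
    rw [← h, (mem_filter.1 hb).2]
  · exact hw a ha

omit [Fintype J] in
theorem lapl_eq_zero_of_nonroot [Finite J] (hr : IsRoot src tgt root) {z : J → V}
    (h : ∀ a, root a ≠ a → lapl src tgt x z a = 0) (a : J) : lapl src tgt x z a = 0 := by
  cases nonempty_fintype J
  exact eq_zero_of_sum_class_eq_zero h (sum_class_lapl hr z) a

theorem sum_lapMat_smul (z : J → V) (a : J) :
    ∑ b, lapMat src tgt x a b • z b = lapl src tgt x z a := by
  have hsrc : ∑ b, (∑ j with src j = a ∧ tgt j = b, x j) • z b
      = ∑ j with src j = a, x j • z (tgt j) := by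
    rw [← sum_fiberwise _ tgt]
    refine sum_congr rfl fun b _ => ?_
    rw [sum_smul, filter_filter]
    exact sum_congr rfl fun j hj => by rw [(mem_filter.1 hj).2.2]
  simp only [lapMat, Matrix.of_apply, sub_smul, sum_sub_distrib, ite_smul, zero_smul,
    Fintype.sum_ite_eq, hsrc, lapl]

theorem sum_dirichletMat_smul (z : J → V) (a : J) :
    ∑ b, dirichletMat src tgt root x a b • z b
      = if root a = a then z a else lapl src tgt x z a := by
  simp only [dirichletMat, Matrix.of_apply]
  split_ifs
  · simp [Matrix.one_apply]
  · exact sum_lapMat_smul z a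

open scoped Matrix.Module in
theorem exists_dirichlet_solution (hdet : IsUnit (dirichletMat src tgt root x).det) (w : J → V) :
    ∃ z : J → V, (∀ a, root a = a → z a = w a) ∧
      ∀ a, root a ≠ a → lapl src tgt x z a = w a := by
  obtain ⟨z, hz⟩ := ((Matrix.isUnit_iff_isUnit_det _).2 hdet).smul_bijective.2 w
  have h (a) := (sum_dirichletMat_smul (src := src) z a).symm.trans (congrFun hz a)
  exact ⟨z, fun a ha => by simpa only [if_pos ha] using h a,
    fun a ha => by simpa only [if_neg ha] using h a⟩

open scoped Matrix.Module in
theorem eq_zero_of_dirichlet (hdet : IsUnit (dirichletMat src tgt root x).det) {z : J → V}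
    (hz : ∀ a, root a = a → z a = 0) (h : ∀ a, root a ≠ a → lapl src tgt x z a = 0) : z = 0 := by
  refine ((Matrix.isUnit_iff_isUnit_det _).2 hdet).smul_bijective.1 (Eq.trans ?_ (smul_zero _).symm)
  ext a
  refine (sum_dirichletMat_smul z a).trans ?_
  split_ifs with ha
  exacts [hz a ha, h a ha]

end module

section map

variable {R' : Type*} [CommRing R'] (f : R →+* R') {x : ι → R}

theorem dirichletMat_map [Fintype J] :
    f.mapMatrix (dirichletMat src tgt root x) = dirichletMat src tgt root (fun j => f (x j)) := by
  ext a b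
  simp only [dirichletMat, lapMat, RingHom.mapMatrix_apply, Matrix.map_apply, Matrix.of_apply,
    Matrix.one_apply, apply_ite f, map_sub, map_sum, map_one, map_zero]

theorem IsStationary.map {B : J → R} (hB : IsStationary src tgt root x B) :
    IsStationary src tgt root (fun j => f (x j)) (fun a => f (B a)) where
  eq_one a ha := by rw [hB.eq_one a ha, map_one]
  lapl_eq_zero a := by
    rw [← map_zero f, ← hB.lapl_eq_zero a]
    simp [lapl, map_sum]

end map

section stationary

variable {x : ι → R}

theorem exists_isStationary [Fintype J] (hr : IsRoot src tgt root)
    (hdet : IsUnit (dirichletMat src tgt root x).det) :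
    ∃ B, IsStationary src tgt root x B := by
  obtain ⟨B, h1, h⟩ := exists_dirichlet_solution hdet fun a => if root a = a then (1 : R) else 0
  exact ⟨B, fun a ha => (h1 a ha).trans (if_pos ha),
    lapl_eq_zero_of_nonroot hr fun a ha => (h a ha).trans (if_neg ha)⟩

theorem IsStationary.unique [Fintype J] (hdet : IsUnit (dirichletMat src tgt root x).det)
    {B B' : J → R} (hB : IsStationary src tgt root x B) (hB' : IsStationary src tgt root x B') :
    B = B' :=
  sub_eq_zero.1 <| eq_zero_of_dirichlet hdet
    (fun a ha => by rw [Pi.sub_apply, hB.eq_one a ha, hB'.eq_one a ha, sub_self])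
    fun a _ => by rw [lapl_sub, hB.lapl_eq_zero, hB'.lapl_eq_zero, sub_self]

theorem IsStationary.sum_mul_eq {B : J → R} (hB : IsStationary src tgt root x B) (a : J) :
    ∑ j with src j = a, x j * B (tgt j) = (∑ j with tgt j = a, x j) * B a :=
  (sub_eq_zero.1 (hB.lapl_eq_zero a)).symm

theorem IsStationary.reverse {B : J → R} (hB : IsStationary src tgt root x B) {y : ι → R}
    (hy : ∀ j, y j * B (src j) = x j * B (tgt j)) : IsStationary tgt src root y B where
  eq_one := hB.eq_one
  lapl_eq_zero a := by
    rw [lapl_eq_sum_sub_sum, ← neg_eq_zero, neg_sub]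
    simpa only [smul_eq_mul, hy, lapl_eq_sum_sub_sum] using hB.lapl_eq_zero a

end stationary

section real

variable {x : ι → ℝ}

theorem lapl_abs_eq_zero [Finite J] (hr : IsRoot src tgt root) (hx : ∀ j, 0 < x j) {z : J → ℝ}
    (hz : ∀ a, lapl src tgt x z a = 0) (a : J) : lapl src tgt x |z| a = 0 := by
  cases nonempty_fintype J
  refine (sum_eq_zero_iff_of_nonpos fun a _ => ?_).1 (sum_class_lapl hr |z| (root a)) a (by simp)
  have hdeg : 0 ≤ ∑ j with tgt j = a, x j := sum_nonneg fun j _ => (hx j).le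
  have h := sub_eq_zero.1 (hz a)
  refine sub_nonpos.2 ?_
  calc (∑ j with tgt j = a, x j) * |z a|
      = |∑ j with src j = a, x j * z (tgt j)| := by
        rw [← abs_of_nonneg hdeg, ← abs_mul]
        exact congrArg _ h
    _ ≤ ∑ j with src j = a, |x j * z (tgt j)| := abs_sum_le_sum_abs _ _
    _ = ∑ j with src j = a, x j * |z (tgt j)| :=
        sum_congr rfl fun j _ => by rw [abs_mul, abs_of_pos (hx j)]

theorem eq_zero_of_reflTransGen (hx : ∀ j, 0 < x j) {z : J → ℝ} (hnonneg : 0 ≤ z)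
    (hz : ∀ a, lapl src tgt x z a = 0) {a b : J}
    (hab : Relation.ReflTransGen (Edge src tgt) a b) (ha : z a = 0) : z b = 0 := by
  induction hab with
  | refl => exact ha
  | tail _ h ih =>
    obtain ⟨j, rfl, rfl⟩ := h
    have hsum := hz (src j)
    rw [lapl, ih, smul_zero, zero_sub, neg_eq_zero] at hsum
    have := (sum_eq_zero_iff_of_nonneg fun i _ => mul_nonneg (hx i).le (hnonneg _)).1 hsum j
      (by simp)
    exact (mul_eq_zero.1 this).resolve_left (hx j).ne'

theorem eq_zero_of_lapl_eq_zero [Finite J] (hr : IsRoot src tgt root) (hx : ∀ j, 0 < x j)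
    {z : J → ℝ} (hz : ∀ a, lapl src tgt x z a = 0) (hroot : ∀ a, root a = a → z a = 0) : z = 0 := by
  ext a
  refine abs_eq_zero.1 (eq_zero_of_reflTransGen (z := |z|) hx (abs_nonneg z)
    (lapl_abs_eq_zero hr hx hz) (hr.from_root a) ?_)
  rw [Pi.abs_apply, hroot _ (hr.idem a), abs_zero]

theorem isUnit_det_dirichletMat_real [Fintype J] (hr : IsRoot src tgt root) (hx : ∀ j, 0 < x j) :
    IsUnit (dirichletMat src tgt root x).det := by
  refine isUnit_iff_ne_zero.2 fun hdet => ?_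
  obtain ⟨z, hz0, hz⟩ := Matrix.exists_mulVec_eq_zero_iff.2 hdet
  have h (a) : (if root a = a then z a else lapl src tgt x z a) = 0 :=
    (sum_dirichletMat_smul z a).symm.trans (congrFun hz a)
  have hlap : ∀ a, lapl src tgt x z a = 0 :=
    lapl_eq_zero_of_nonroot hr fun a ha => by simpa only [if_neg ha] using h a
  exact hz0 (eq_zero_of_lapl_eq_zero hr hx hlap fun a ha => by simpa only [if_pos ha] using h a)

theorem IsStationary.pos [Finite J] (hr : IsRoot src tgt root) (hx : ∀ j, 0 < x j) {B : J → ℝ}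
    (hB : IsStationary src tgt root x B) (a : J) : 0 < B a := by
  cases nonempty_fintype J
  have habs : |B| = B := by
    refine IsStationary.unique (isUnit_det_dirichletMat_real hr hx)
      ⟨fun a ha => ?_, lapl_abs_eq_zero hr hx hB.lapl_eq_zero⟩ hB
    rw [Pi.abs_apply, hB.eq_one a ha, abs_one]
  have hnonneg : 0 ≤ B := habs ▸ abs_nonneg B
  refine (hnonneg a).lt_of_ne fun h => one_ne_zero (α := ℝ) ?_
  rw [← hB.eq_one _ (hr.idem a)]
  exact eq_zero_of_reflTransGen hx hnonneg hB.lapl_eq_zero (hr.to_root a) h.symm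

theorem isUnit_det_dirichletMat [Fintype J] (hr : IsRoot src tgt root) (ev : R →+* ℝ)
    [IsLocalHom ev] {x : ι → R} (hx : ∀ j, 0 < ev (x j)) :
    IsUnit (dirichletMat src tgt root x).det := by
  refine IsUnit.of_map ev _ ?_
  rw [ev.map_det, dirichletMat_map]
  exact isUnit_det_dirichletMat_real hr hx

end real

end laplacian

section mem

variable {ι J K : Type*} [Fintype ι] [Fintype J] [DecidableEq J] {src tgt : ι → J} {root : J → J}
  [Field K] {x : ι → K} {B : J → K}

theorem IsStationary.mem {S : Type*} [SetLike S K] [SubfieldClass S K] (E : S)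
    (hr : IsRoot src tgt root) (hdet : IsUnit (dirichletMat src tgt root x).det)
    (hB : IsStationary src tgt root x B) (hx : ∀ j, x j ∈ E) (a : J) : B a ∈ E := by
  lift x to ι → E using hx
  let f : E →+* K := SubringClass.subtype E
  have hdetE : IsUnit (dirichletMat src tgt root x).det := by
    refine IsUnit.of_map f _ ?_
    rwa [f.map_det, dirichletMat_map]
  obtain ⟨B', hB'⟩ := exists_isStationary hr hdetE
  rw [hB.unique hdet (hB'.map f)]
  exact (B' a).2

end mem

/-! ### Changing the nef partition -/

section twist

variable {n : ℕ} {ι J : Type*} {v : ι → Latt n} {M : J → DualLatt n}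

/-- The elements `M_a` of the dual lattice witness that the divisors `∑ D_j`, where the sum is over
the `j` with `src j = a`, and the divisors `∑ D_j`, where the sum is over the `j` with `tgt j = a`,
are linearly equivalent. -/
def IsTransition [DecidableEq J] (src tgt : ι → J) (v : ι → Latt n) (M : J → DualLatt n) : Prop :=
  ∀ a j, M a (v j) = (if src j = a then 1 else 0) - if tgt j = a then 1 else 0

variable [Fintype J] {K : Type*} [Field K] {p : AddChar (Latt n) K} {B : J → K}

/-- The twist of the point `p` of the torus by the cocharacters `-M_a`, evaluated at `B_a`. -/
def twist (p : AddChar (Latt n) K) (M : J → DualLatt n) (hB : ∀ a, B a ≠ 0) :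
    AddChar (Latt n) K :=
  p * ∏ a, cochar (B a) (hB a) (-M a)

variable (hB : ∀ a, B a ≠ 0)

theorem twist_apply (w : Latt n) : twist p M hB w = p w * ∏ a, B a ^ (-M a w) := by
  simp only [twist, AddChar.mul_apply, AddChar.prod_apply, cochar_apply, LinearMap.neg_apply]

theorem mem_of_twist_mem {S : Type*} [SetLike S K] [SubfieldClass S K] {E : S}
    (hBE : ∀ a, B a ∈ E) {w : Latt n} (hw : twist p M hB w ∈ E) : p w ∈ E := by
  rw [twist_apply] at hw
  rw [← mul_inv_cancel_right₀ (prod_ne_zero_iff.2 fun a _ => zpow_ne_zero (-M a w) (hB a)) (p w)]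
  exact mul_mem hw (inv_mem (prod_mem fun a _ => zpow_mem (hBE a) _))

variable [DecidableEq J] {src tgt : ι → J}

theorem twist_ray_mul (hM : IsTransition src tgt v M) (j : ι) :
    twist p M hB (v j) * B (src j) = p (v j) * B (tgt j) := by
  have hprod : ∏ a, B a ^ (-M a (v j)) = B (tgt j) / B (src j) := by
    simp only [hM _ j, neg_sub, zpow_sub₀ (hB _), pow_ite, zpow_one, zpow_zero,
      prod_div_distrib, Fintype.prod_ite_eq]
  rw [twist_apply, hprod, mul_assoc, div_mul_cancel₀ _ (hB _)]

theorem sum_twist_ray [Fintype ι] {root : J → J} (hM : IsTransition src tgt v M)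
    (hst : IsStationary src tgt root (fun j => p (v j)) B) (a : J) :
    ∑ j with src j = a, twist p M hB (v j) = ∑ j with tgt j = a, p (v j) := by
  refine mul_right_cancel₀ (hB a) ?_
  rw [← hst.sum_mul_eq, sum_mul]
  exact sum_congr rfl fun j hj => by rw [← twist_ray_mul hB hM, (mem_filter.1 hj).2]

end twist

section transition

variable {m n : ℕ} {ι J : Type*} [Fintype J] [DecidableEq J] {src tgt : ι → J} {root : J → J}
  {v : ι → Latt n} {M : J → DualLatt n} {p : AddChar (Latt n) (FunField m)} {B : J → FunField m}
  {hB : ∀ a, B a ≠ 0}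

theorem twist_ray_mem_posAtOne (hM : IsTransition src tgt v M) (hp : ∀ j, p (v j) ∈ posAtOne m)
    (hpos : ∀ a, B a ∈ posAtOne m) (j : ι) : twist p M hB (v j) ∈ posAtOne m := by
  rw [(eq_mul_inv_iff_mul_eq₀ (hB _)).2 (twist_ray_mul hB hM j)]
  exact mul_mem (mul_mem (hp j) (hpos _)) (inv_mem_posAtOne (hpos _))

variable [Fintype ι] {x : ι → FunField m}

theorem isUnit_det_dirichletMat_of_mem_posAtOne (hr : IsRoot src tgt root)
    (hx : ∀ j, x j ∈ posAtOne m) : IsUnit (dirichletMat src tgt root x).det := by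
  choose t htpos htx using hx
  have hdet := (isUnit_det_dirichletMat hr (evalOne m) htpos).map (toRat m)
  rwa [(toRat m).map_det, dirichletMat_map, funext htx] at hdet

omit [Fintype J] in
theorem exists_isStationary_mem_posAtOne [Finite J] (hr : IsRoot src tgt root)
    (hx : ∀ j, x j ∈ posAtOne m) :
    ∃ B, IsStationary src tgt root x B ∧ ∀ a, B a ∈ posAtOne m := by
  cases nonempty_fintype J
  choose t htpos htx using hx
  obtain ⟨B, hB⟩ := exists_isStationary hr (isUnit_det_dirichletMat hr (evalOne m) htpos)
  refine ⟨fun a => toRat m (B a), funext htx ▸ hB.map (toRat m), fun a => ⟨B a, ?_, rfl⟩⟩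
  exact (hB.map (evalOne m)).pos hr htpos a

-- `B` is the stationary vector of the reversed digraph weighted by the twisted point.
theorem apply_mem_residueField_twist (hr : IsRoot src tgt root) (hM : IsTransition src tgt v M)
    (hp : ∀ j, p (v j) ∈ posAtOne m) (hst : IsStationary src tgt root (fun j => p (v j)) B)
    (hpos : ∀ a, B a ∈ posAtOne m) (w : Latt n) : p w ∈ residueField (twist p M hB) := by
  have hrev := hst.reverse (twist_ray_mul hB hM)
  have hdet := isUnit_det_dirichletMat_of_mem_posAtOne hr.symm
    (twist_ray_mem_posAtOne (hB := hB) hM hp hpos)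
  exact mem_of_twist_mem hB
    (hrev.mem _ hr.symm hdet fun j => apply_mem_residueField _ (v j)) (apply_mem_residueField _ w)

end transition

/-! ### Logarithmic differentials and gradients -/

section extension

open TensorProduct

/-- The vector space `N ⊗ K`. -/
abbrev LattK (K : Type*) [Field K] (n : ℕ) := K ⊗[ℤ] Latt n

variable {K : Type*} [Field K] {n : ℕ}

/-- A vector of the lattice `N` as an element of `N ⊗ K`. -/
def vec (K : Type*) [Field K] (v : Latt n) : LattK K n := 1 ⊗ₜ v

/-- The `K`-linear form on `N ⊗ K` that extends the element `w` of the dual lattice. -/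
def dualK (K : Type*) [Field K] (w : DualLatt n) : LattK K n →ₗ[K] K :=
  (Algebra.linearMap ℤ K ∘ₗ w).liftBaseChange K

@[simp]
theorem dualK_vec (w : DualLatt n) (v : Latt n) : dualK K w (vec K v) = (w v : K) :=
  LinearMap.liftBaseChange_one_tmul _ _ _

theorem linearMap_ext_vec {E : Type*} [AddCommGroup E] [Module K E] {f g : LattK K n →ₗ[K] E}
    (h : ∀ v, f (vec K v) = g (vec K v)) : f = g :=
  TensorProduct.AlgebraTensorModule.curry_injective
    (LinearMap.ext_ring (LinearMap.ext h))

/-- The logarithmic gradient of `∑ z^{v_j}`, where the sum is over the `j` with `part j = a`, at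
the point `p` of the torus. -/
def grad {ι J : Type*} [Fintype ι] [DecidableEq J] (part : ι → J) (v : ι → Latt n)
    (p : AddChar (Latt n) K) (a : J) : LattK K n :=
  ∑ j with part j = a, p (v j) • vec K (v j)

end extension

section dlog

variable {K : Type*} [Field K] [Algebra ℂ K]

/-- The logarithmic differential `d log x`. -/
def dlog (x : K) : Ω[K⁄ℂ] := x⁻¹ • KaehlerDifferential.D ℂ K x

theorem smul_dlog {x : K} (hx : x ≠ 0) : x • dlog x = KaehlerDifferential.D ℂ K x :=
  smul_inv_smul₀ hx _

theorem dlog_one : dlog (1 : K) = 0 := by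
  rw [dlog, Derivation.map_one_eq_zero, smul_zero]

theorem dlog_mul {x y : K} (hx : x ≠ 0) (hy : y ≠ 0) : dlog (x * y) = dlog x + dlog y := by
  simp only [dlog, Derivation.leibniz, smul_add, smul_smul, mul_inv_rev]
  rw [inv_mul_cancel_right₀ hx, mul_right_comm, inv_mul_cancel₀ hy, one_mul, add_comm]

theorem dlog_zpow {x : K} (hx : x ≠ 0) (k : ℤ) : dlog (x ^ k) = k • dlog x := by
  rw [dlog, Derivation.leibniz_zpow, smul_comm _ k, smul_smul, ← zpow_neg, ← zpow_add₀ hx, dlog]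
  congr 2
  rw [← zpow_neg_one]
  congr 1
  ring

theorem dlog_prod {κ : Type*} {s : Finset κ} {x : κ → K} (hx : ∀ i, x i ≠ 0) :
    dlog (∏ i ∈ s, x i) = ∑ i ∈ s, dlog (x i) := by
  classical
  induction s using Finset.induction_on with
  | empty => exact dlog_one
  | insert a s ha ih =>
    rw [prod_insert ha, sum_insert ha, dlog_mul (hx a) (prod_ne_zero_iff.2 fun i _ => hx i), ih]

variable {n : ℕ} {p : AddChar (Latt n) K}

/-- The `K`-linear extension of `v ↦ d log p(v)`: the pull-back along `p` of the invariant
differentials on the torus, identified with `N ⊗ K`. -/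
def dlogMap (p : AddChar (Latt n) K) : LattK K n →ₗ[K] Ω[K⁄ℂ] :=
  (AddMonoidHom.mk' (fun v => dlog (p v)) fun v w => by
    rw [AddChar.map_add_eq_mul, dlog_mul (addChar_ne_zero p v)
      (addChar_ne_zero p w)]).toIntLinearMap.liftBaseChange K

@[simp]
theorem dlogMap_vec (v : Latt n) : dlogMap p (vec K v) = dlog (p v) :=
  LinearMap.liftBaseChange_one_tmul _ _ _

theorem dlogMap_smul_vec (v : Latt n) :
    dlogMap p (p v • vec K v) = KaehlerDifferential.D ℂ K (p v) := by
  rw [map_smul, dlogMap_vec, smul_dlog (addChar_ne_zero p v)]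

theorem dlogMap_grad {ι J : Type*} [Fintype ι] [DecidableEq J] {part : ι → J} {v : ι → Latt n}
    (a : J) :
    dlogMap p (grad part v p a) = KaehlerDifferential.D ℂ K (∑ j with part j = a, p (v j)) := by
  simp only [grad, map_sum, dlogMap_smul_vec]

end dlog

/-! ### The Jacobian of the change of nef partition -/

section determinants

open Matrix

theorem det_ite_one_row {J R : Type*} [Fintype J] [DecidableEq J] [CommRing R] (p : J → Prop)
    [DecidablePred p] (X : Matrix J J R) :
    (Matrix.of fun a b => if p a then (1 : Matrix J J R) a b else X a b).det
      = (X.toSquareBlockProp fun a => ¬p a).det := by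
  rw [Matrix.twoBlockTriangular_det' _ p]
  · have hone : (Matrix.of fun a b => if p a then (1 : Matrix J J R) a b else X a b
        ).toSquareBlockProp p = 1 := by
      ext a b
      simp [Matrix.toSquareBlockProp, a.2, Matrix.one_apply, Subtype.ext_iff]
    rw [hone, Matrix.det_one, one_mul]
    congr 1
    ext a b
    simp [Matrix.toSquareBlockProp, a.2]
  · intro a ha b hb
    have hab : a ≠ b := fun h => hb (h ▸ ha)
    simp [ha, hab]

theorem det_one_sub_comp_comm {K E F : Type*} [Field K] [AddCommGroup E] [AddCommGroup F]
    [Module K E] [Module K F] [FiniteDimensional K E] [FiniteDimensional K F] (f : E →ₗ[K] F)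
    (g : F →ₗ[K] E) : LinearMap.det (1 - f ∘ₗ g) = LinearMap.det (1 - g ∘ₗ f) := by
  let b := Module.finBasis K E
  let b' := Module.finBasis K F
  rw [← LinearMap.det_toMatrix b', ← LinearMap.det_toMatrix b, map_sub, map_sub,
    LinearMap.toMatrix_one, LinearMap.toMatrix_one, LinearMap.toMatrix_comp b' b b',
    LinearMap.toMatrix_comp b b' b, Matrix.det_one_sub_mul_comm]

theorem det_ite_one_row_transpose {J R : Type*} [Fintype J] [DecidableEq J] [CommRing R]
    (p : J → Prop) [DecidablePred p] (X : Matrix J J R) :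
    (Matrix.of fun a b => if p a then (1 : Matrix J J R) a b else X b a).det
      = (Matrix.of fun a b => if p a then (1 : Matrix J J R) a b else X a b).det := by
  rw [det_ite_one_row p X, ← det_transpose (X.toSquareBlockProp _)]
  exact det_ite_one_row p Xᵀ

end determinants

section jacobian

open Matrix

variable {K : Type*} [Field K] {n : ℕ} {ι J : Type*} [Fintype ι] [DecidableEq J]
  {src tgt : ι → J} {root : J → J} {v : ι → Latt n} {M : J → DualLatt n} {p : AddChar (Latt n) K}
  {B : J → K}

/-- The right-hand side of the linear system for the logarithmic gradients of the `B_a`, obtained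
by differentiating the equations `lapl B = 0`. -/
def gradRhs (src tgt : ι → J) (v : ι → Latt n) (p : AddChar (Latt n) K) (B : J → K) (a : J) :
    LattK K n :=
  ∑ j with src j = a, (p (v j) * B (tgt j)) • vec K (v j) - B a • grad tgt v p a

/-- The vectors `κ_a` are logarithmic gradients of the coordinates `B_a` of a stationary vector of
the digraph with weights `p(v_j)`, seen as functions of the point `p` of the torus. -/
structure IsGradient (src tgt : ι → J) (root : J → J) (v : ι → Latt n) (p : AddChar (Latt n) K)
    (B : J → K) (κ : J → LattK K n) : Prop where
  eq_zero : ∀ a, root a = a → κ a = 0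
  lapl_eq : ∀ a, lapl src tgt (fun j => p (v j)) κ a = gradRhs src tgt v p B a

theorem sum_class_gradRhs [Fintype J] (hr : IsRoot src tgt root) (r : J) :
    ∑ a with root a = r, gradRhs src tgt v p B a = 0 := by
  have h (a) : B a • grad tgt v p a
      = ∑ j with tgt j = a, (p (v j) * B (tgt j)) • vec K (v j) := by
    rw [grad, smul_sum]
    exact sum_congr rfl fun j hj => by rw [(mem_filter.1 hj).2, smul_smul, mul_comm]
  simp only [gradRhs, h, sum_sub_distrib, sum_class_sum_fiber, hr.root_eq, sub_self]

theorem exists_isGradient [Fintype J] (hr : IsRoot src tgt root)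
    (hdet : IsUnit (dirichletMat src tgt root fun j => p (v j)).det) :
    ∃ κ, IsGradient src tgt root v p B κ := by
  obtain ⟨κ, hκ0, hκ⟩ := exists_dirichlet_solution hdet
    fun a => if root a = a then 0 else gradRhs src tgt v p B a
  refine ⟨κ, fun a ha => (hκ0 a ha).trans (if_pos ha), fun a => sub_eq_zero.1 ?_⟩
  refine eq_zero_of_sum_class_eq_zero (root := root)
    (w := fun a => lapl src tgt (fun j => p (v j)) κ a - gradRhs src tgt v p B a)
    (fun a ha => ?_) (fun r => ?_) a
  · rw [hκ a ha, if_neg ha, sub_self]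
  · rw [sum_sub_distrib, sum_class_lapl hr, sum_class_gradRhs hr, sub_self]

section derivative

variable [Algebra ℂ K]

theorem dlogMap_gradRhs {a : J} (hB : lapl src tgt (fun j => p (v j)) B a = 0) :
    dlogMap p (gradRhs src tgt v p B a)
      = lapl src tgt (fun j => p (v j)) (fun b => KaehlerDifferential.D ℂ K (B b)) a := by
  have hD := congrArg (KaehlerDifferential.D ℂ K) hB
  simp only [lapl, smul_eq_mul, map_sub, map_sum, map_zero, Derivation.leibniz,
    sum_add_distrib] at hD
  have hsmul (j) : dlogMap p ((p (v j) * B (tgt j)) • vec K (v j))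
      = B (tgt j) • KaehlerDifferential.D ℂ K (p (v j)) := by
    rw [mul_comm, mul_smul, map_smul, dlogMap_smul_vec]
  rw [gradRhs, map_sub, map_smul, dlogMap_grad, map_sum, lapl]
  simp only [hsmul, map_sum]
  rw [← sub_eq_zero, ← neg_eq_zero, ← hD]
  abel

theorem IsGradient.dlogMap_eq [Fintype J] {κ : J → LattK K n}
    (hκ : IsGradient src tgt root v p B κ)
    (hdet : IsUnit (dirichletMat src tgt root fun j => p (v j)).det)
    (hB : IsStationary src tgt root (fun j => p (v j)) B) (a : J) :
    dlogMap p (κ a) = KaehlerDifferential.D ℂ K (B a) := by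
  rw [← sub_eq_zero]
  refine congrFun (eq_zero_of_dirichlet hdet
    (z := (fun a => dlogMap p (κ a)) - fun a => KaehlerDifferential.D ℂ K (B a))
    (fun a ha => ?_) fun a _ => ?_) a
  · simp [hκ.eq_zero a ha, hB.eq_one a ha]
  · rw [lapl_sub, ← map_lapl, hκ.lapl_eq, dlogMap_gradRhs (hB.lapl_eq_zero a), sub_self]

end derivative

variable [Fintype J]

/-- The Jacobian of the twist in logarithmic coordinates, where `κ_a` is the logarithmic gradient
of `B_a`: the twist multiplies `p(w)` by `∏ B_a ^ (-⟨M_a, w⟩)`. -/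
def jac (M : J → DualLatt n) (B : J → K) (κ : J → LattK K n) : Module.End K (LattK K n) :=
  1 - Fintype.linearCombination K (fun a => (B a)⁻¹ • κ a) ∘ₗ LinearMap.pi fun a => dualK K (M a)

variable {κ : J → LattK K n}

omit [DecidableEq J] in
theorem jac_vec (w : Latt n) :
    jac M B κ (vec K w) = vec K w - ∑ a, (M a w : K) • (B a)⁻¹ • κ a := by
  simp [jac, Fintype.linearCombination_apply]

omit [Fintype ι] in
theorem jac_vec_ray (hM : IsTransition src tgt v M) (j : ι) :
    jac M B κ (vec K (v j)) = vec K (v j) - (B (src j))⁻¹ • κ (src j)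
      + (B (tgt j))⁻¹ • κ (tgt j) := by
  rw [jac_vec, sub_add]
  simp only [hM _ j, Int.cast_sub, Int.cast_ite, Int.cast_one, Int.cast_zero, sub_smul, ite_smul,
    one_smul, zero_smul, sum_sub_distrib, Fintype.sum_ite_eq]

omit [DecidableEq J] in
theorem dlogMap_twist [Algebra ℂ K] (hB : ∀ a, B a ≠ 0)
    (hκ : ∀ a, dlogMap p (κ a) = KaehlerDifferential.D ℂ K (B a)) :
    dlogMap (twist p M hB) = dlogMap p ∘ₗ jac M B κ := by
  refine linearMap_ext_vec fun w => ?_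
  rw [LinearMap.comp_apply, dlogMap_vec, twist_apply, dlog_mul (addChar_ne_zero p w)
    (prod_ne_zero_iff.2 fun a _ => zpow_ne_zero _ (hB a)),
    dlog_prod fun a => zpow_ne_zero _ (hB a), jac_vec, map_sub, dlogMap_vec, map_sum,
    sub_eq_add_neg, ← sum_neg_distrib]
  refine congrArg _ (sum_congr rfl fun a _ => ?_)
  rw [dlog_zpow (hB a), neg_smul, map_smul, map_smul, hκ, Int.cast_smul_eq_zsmul, dlog]

theorem jac_grad_twist (hB : ∀ a, B a ≠ 0) (hM : IsTransition src tgt v M)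
    (hst : IsStationary src tgt root (fun j => p (v j)) B)
    (hκ : IsGradient src tgt root v p B κ) (a : J) :
    jac M B κ (grad src v (twist p M hB) a) = grad tgt v p a := by
  have hterm (j) (hj : src j = a) :
      B a • jac M B κ (twist p M hB (v j) • vec K (v j))
        = (p (v j) * B (tgt j)) • vec K (v j) - (p (v j) • B (tgt j)) • (B a)⁻¹ • κ a
          + p (v j) • κ (tgt j) := by
    rw [map_smul, smul_smul, mul_comm, ← hj, twist_ray_mul hB hM, jac_vec_ray hM, smul_add,
      smul_sub, smul_smul _ _ (κ (tgt j)), mul_inv_cancel_right₀ (hB _), smul_eq_mul]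
  have hsum := sum_congr (s₁ := {j | src j = a}) rfl fun j hj => hterm j (mem_filter.1 hj).2
  have hBa := hst.lapl_eq_zero a
  have hκa := hκ.lapl_eq a
  rw [lapl, sub_eq_zero] at hBa
  rw [lapl, gradRhs] at hκa
  rw [← smul_sum, ← map_sum, sum_add_distrib, sum_sub_distrib, ← sum_smul, ← hBa, smul_eq_mul,
    smul_smul, mul_inv_cancel_right₀ (hB a)] at hsum
  refine smul_right_injective _ (hB a) (hsum.trans ?_)
  rw [← sub_eq_zero, sub_eq_iff_eq_add.1 hκa]
  abel

/-- The matrix of the Jacobian `jac` on the logarithmic coordinates `B_a`, scaled by `B`. -/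
def jacMat (M : J → DualLatt n) (B : J → K) (κ : J → LattK K n) : Matrix J J K :=
  Matrix.of fun b i => (if b = i then B b else 0) - dualK K (M i) (κ b)

theorem lapMat_mul_jacMat (hM : IsTransition src tgt v M)
    (hst : IsStationary src tgt root (fun j => p (v j)) B)
    (hκ : IsGradient src tgt root v p B κ) :
    lapMat src tgt (fun j => p (v j)) * jacMat M B κ
      = -(Matrix.diagonal B * (lapMat src tgt fun j => p (v j))ᵀ) := by
  ext a i
  have hz := sum_lapMat_smul (src := src) (tgt := tgt) (x := fun j => p (v j))
    ((fun b => if b = i then B b else 0) - fun b => dualK K (M i) (κ b)) a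
  refine (Matrix.mul_apply.trans hz).trans ?_
  have hBa := hst.lapl_eq_zero a
  rw [lapl, sub_eq_zero] at hBa
  rw [lapl_sub, ← map_lapl, hκ.lapl_eq, gradRhs, map_sub, map_smul, grad, map_sum, map_sum]
  simp only [map_smul, dualK_vec, hM _ _, Int.cast_sub, Int.cast_ite, Int.cast_one, Int.cast_zero,
    lapl, smul_eq_mul, Matrix.neg_apply, Matrix.diagonal_mul, Matrix.transpose_apply, lapMat,
    Matrix.of_apply, mul_sub, sum_sub_distrib, mul_ite, mul_one, mul_zero] at hBa ⊢
  simp only [← sum_filter, filter_filter, and_comm (a := tgt _ = a)]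
  obtain rfl | hai := eq_or_ne a i
  · simp only [and_self, if_true, ← hBa]
    ring
  · have hempty (f : ι → J) {b c : J} (hbc : b ≠ c) :
        ({j | f j = b ∧ f j = c} : Finset ι) = ∅ :=
      filter_eq_empty_iff.2 fun j _ h => hbc (h.1.symm.trans h.2)
    rw [if_neg hai, if_neg hai.symm, hempty _ hai, hempty _ hai.symm, sum_empty]
    ring

theorem det_jacMat_sq (hM : IsTransition src tgt v M)
    (hdet : IsUnit (dirichletMat src tgt root fun j => p (v j)).det)
    (hst : IsStationary src tgt root (fun j => p (v j)) B)
    (hκ : IsGradient src tgt root v p B κ) :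
    (jacMat M B κ).det ^ 2 = (∏ a, B a) ^ 2 := by
  let B' : J → K := fun a => if root a = a then 1 else -B a
  let Λ := lapMat src tgt fun j => p (v j)
  have hmul : dirichletMat src tgt root (fun j => p (v j)) * jacMat M B κ
      = Matrix.diagonal B' * Matrix.of fun a b =>
        if root a = a then (1 : Matrix J J K) a b else Λ b a := by
    ext a i
    rw [Matrix.diagonal_mul, Matrix.mul_apply]
    by_cases ha : root a = a
    · simp [B', dirichletMat, ha, jacMat, hst.eq_one a ha, hκ.eq_zero a ha, Matrix.one_apply]
    · have h := congrFun₂ (lapMat_mul_jacMat hM hst hκ) a i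
      rw [Matrix.mul_apply] at h
      simpa [B', Λ, dirichletMat, ha] using h
  have hdetmul := congrArg Matrix.det hmul
  rw [Matrix.det_mul, Matrix.det_mul, Matrix.det_diagonal, det_ite_one_row_transpose, mul_comm]
    at hdetmul
  rw [mul_right_cancel₀ hdet.ne_zero hdetmul, ← prod_pow, ← prod_pow]
  refine prod_congr rfl fun a _ => ?_
  by_cases ha : root a = a
  · simp [B', ha, hst.eq_one a ha]
  · simp [B', ha]

omit [Fintype ι] in
theorem det_jac (hB : ∀ a, B a ≠ 0) :
    LinearMap.det (jac M B κ) = (jacMat M B κ).det * (∏ a, B a)⁻¹ := by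
  rw [jac, det_one_sub_comp_comm, ← LinearMap.det_toMatrix', ← prod_inv_distrib,
    ← Matrix.det_diagonal, ← Matrix.det_transpose (jacMat M B κ), ← Matrix.det_mul]
  congr 1
  ext a b
  obtain rfl | hab := eq_or_ne a b
  · simp [LinearMap.toMatrix'_apply, jacMat, Fintype.linearCombination_apply, mul_sub, mul_comm, hB]
  · simp [LinearMap.toMatrix'_apply, jacMat, Fintype.linearCombination_apply, mul_comm, hab,
      hab.symm]

theorem det_jac_sq (hB : ∀ a, B a ≠ 0) (hM : IsTransition src tgt v M)
    (hdet : IsUnit (dirichletMat src tgt root fun j => p (v j)).det)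
    (hst : IsStationary src tgt root (fun j => p (v j)) B)
    (hκ : IsGradient src tgt root v p B κ) : LinearMap.det (jac M B κ) ^ 2 = 1 := by
  rw [det_jac hB, mul_pow, det_jacMat_sq hM hdet hst hκ, ← mul_pow,
    mul_inv_cancel₀ (prod_ne_zero_iff.2 fun a _ => hB a), one_pow]

end jacobian

/-! ### Comparison of volume forms -/

section determinants

open Module

theorem alternatingMap_apply_eq_det_smul {K V W κ : Type*} [CommRing K] [AddCommGroup V]
    [Module K V] [AddCommGroup W] [Module K W] [Fintype κ] [DecidableEq κ] (e : Basis κ K V)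
    (f : V [⋀^κ]→ₗ[K] W) (y : κ → V) : f y = e.det y • f e := by
  suffices h : f = (LinearMap.toSpanSingleton K W (f e)).compAlternatingMap e.det from
    congrArg (fun g : V [⋀^κ]→ₗ[K] W => g y) h
  refine Basis.ext_alternating e fun i hi => ?_
  let τ : Equiv.Perm κ := Equiv.ofBijective i (Finite.injective_iff_bijective.1 hi)
  change f (e ∘ τ) = e.det (e ∘ τ) • f e
  rw [f.map_perm, e.det.map_perm, Basis.det_self, smul_assoc, one_smul]

variable {K V : Type*} [Field K] [AddCommGroup V] [Module K V] {α κ : Type*} [Fintype α]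
  [DecidableEq α] [Fintype κ] [DecidableEq κ]

theorem det_sumElim_inl (b : Basis (α ⊕ κ) K V) (x : κ → V) :
    b.det (Sum.elim (b ∘ Sum.inl) x)
      = (Pi.basisFun K κ).det fun k j => b.repr (x k) (Sum.inr j) := by
  have hblocks : b.toMatrix (Sum.elim (b ∘ Sum.inl) x)
      = Matrix.fromBlocks 1 (Matrix.of fun i k => b.repr (x k) (Sum.inl i)) 0
        ((Pi.basisFun K κ).toMatrix fun k j => b.repr (x k) (Sum.inr j)) := by
    ext (i | i) (j | j) <;>
      simp [Basis.toMatrix_apply, Matrix.one_apply, Finsupp.single_apply, eq_comm]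
  rw [Basis.det_apply, hblocks, Matrix.det_fromBlocks_zero₂₁, Matrix.det_one, one_mul,
    Basis.det_apply]

theorem alternatingMap_comp_of_apply_inl_eq_zero {V' W : Type*} [AddCommGroup V'] [Module K V']
    [AddCommGroup W] [Module K W] (b : Basis (α ⊕ κ) K V) {T : V →ₗ[K] V'}
    (hT : ∀ i, T (b (Sum.inl i)) = 0) (f : V' [⋀^κ]→ₗ[K] W) (x : κ → V) :
    f (T ∘ x) = b.det (Sum.elim (b ∘ Sum.inl) x) • f (T ∘ b ∘ Sum.inr) := by
  let g : (κ → K) →ₗ[K] V' := Fintype.linearCombination K (T ∘ b ∘ Sum.inr)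
  have hTg : T ∘ x = g ∘ fun k j => b.repr (x k) (Sum.inr j) := by
    ext k
    rw [Function.comp_apply, ← b.sum_repr (x k), map_sum, Fintype.sum_sum_type]
    simp [g, Fintype.linearCombination_apply, hT]
  have hg : g ∘ Pi.basisFun K κ = T ∘ b ∘ Sum.inr := by
    ext k
    simp [g, Fintype.linearCombination_apply_single]
  rw [det_sumElim_inl, hTg, ← hg]
  exact alternatingMap_apply_eq_det_smul (Pi.basisFun K κ) (f.compLinearMap g) _

theorem det_baseChange_sq {N : Type*} [AddCommGroup N] (e e' : Basis κ ℤ N) :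
    (e.baseChange K).det (e'.baseChange K) ^ 2 = 1 := by
  have hcast : (e.baseChange K).det (e'.baseChange K) = Int.castRingHom K (e.det e') := by
    rw [Basis.det_apply, Basis.det_apply, RingHom.map_det]
    congr 1
    ext i j
    simp [Basis.toMatrix_apply, Basis.baseChange_apply, Basis.baseChange_repr_tmul]
  rw [hcast, ← map_pow, Int.isUnit_sq (e.isUnit_det e'), map_one]

end determinants

section frame

variable {n m c : ℕ} {u : Fin c → DualLatt n} {q : Latt n →+ Latt m}

namespace Splitting

/-- The basis of `N` that corresponds to the standard basis of `ℤᶜ × ℤᵐ`. -/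
def basis (σ : Splitting u q) : Module.Basis (Fin c ⊕ Fin m) ℤ (Latt n) :=
  ((Pi.basisFun ℤ (Fin c)).prod (Pi.basisFun ℤ (Fin m))).map σ.equiv.symm

variable (σ : Splitting u q)

theorem basis_repr_inl (v : Latt n) (i : Fin c) : σ.basis.repr v (Sum.inl i) = u i v := by
  simp [basis, σ.equiv_apply]

theorem basis_repr_inr (v : Latt n) (j : Fin m) : σ.basis.repr v (Sum.inr j) = q v j := by
  simp [basis, σ.equiv_apply]

end Splitting

variable {K : Type*} [Field K] {ι : Type*} [DecidableEq ι] [Fintype ι]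
  {Y : SmoothCompleteFan n ι} {L : Fin c → Y.Pic}

/-- The gradients of the `G_i` and a basis of `⋂ u_i^⊥`: at a point of the locus
`G_1 = ⋯ = G_c = 1` these form a basis of `N ⊗ K`. -/
def frame (P : NefPartition Y L) (σ : Splitting u q) (p : AddChar (Latt n) K) :
    Fin c ⊕ Fin m → LattK K n :=
  Sum.elim (fun i => grad P.part Y.ray p i.castSucc) fun j => vec K (σ.incl (Pi.single j 1))

variable {P : NefPartition Y L} {p : AddChar (Latt n) K}

theorem det_pairing_grad (hu : P.IsAmenable u) (hp : OnLocus P p) :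
    (Matrix.of fun i j => dualK K (u i) (grad P.part Y.ray p (Fin.castSucc j))).det
      = (-1) ^ c := by
  have hentry (i j : Fin c) : dualK K (u i) (grad P.part Y.ray p j.castSucc)
      = ∑ k ∈ P.S j.castSucc, p (Y.ray k) * (u i (Y.ray k) : K) := by
    simp [grad, NefPartition.S]
  rw [Matrix.det_of_isUpperTriangular]
  · have hdiag (i) : dualK K (u i) (grad P.part Y.ray p (Fin.castSucc i)) = -1 := by
      rw [hentry, ← hp i, ← sum_neg_distrib]
      refine sum_congr rfl fun k hk => ?_
      rw [hu.neg_one i k hk, Int.cast_neg, Int.cast_one, mul_neg_one]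
    simp [hdiag]
  · intro i j hij
    refine (hentry i j).trans (sum_eq_zero fun k hk => ?_)
    rw [hu.zero i j.castSucc (Fin.castSucc_lt_castSucc_iff.mpr hij) k hk, Int.cast_zero, mul_zero]

theorem det_frame (σ : Splitting u q) (hu : P.IsAmenable u) (hp : OnLocus P p) :
    (σ.basis.baseChange K).det (frame P σ p) = (-1) ^ c := by
  have hvec (w i) : (σ.basis.baseChange K).repr (vec K w) i = (σ.basis.repr w i : K) := by
    simp [vec, Module.Basis.baseChange_repr_tmul]
  have hblocks : (σ.basis.baseChange K).toMatrix (frame P σ p)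
      = Matrix.fromBlocks
        (Matrix.of fun i j => dualK K (u i) (grad P.part Y.ray p (Fin.castSucc j))) 0
        (Matrix.of fun i j =>
          (σ.basis.baseChange K).repr (grad P.part Y.ray p (Fin.castSucc j)) (Sum.inr i)) 1 := by
    ext (i | i) (j | j)
    · simp [Module.Basis.toMatrix_apply, frame, grad, hvec, σ.basis_repr_inl]
    · simp [Module.Basis.toMatrix_apply, frame, hvec, σ.basis_repr_inl, σ.apply_incl]
    · rfl
    · simp [Module.Basis.toMatrix_apply, frame, hvec, σ.basis_repr_inr, σ.proj_incl,
        Matrix.one_apply, Pi.single_apply]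
  rw [Module.Basis.det_apply, hblocks, Matrix.det_fromBlocks_zero₁₂, Matrix.det_one, mul_one,
    det_pairing_grad hu hp]

theorem exists_basis_eq_frame (σ : Splitting u q) (hu : P.IsAmenable u) (hp : OnLocus P p) :
    ∃ b : Module.Basis (Fin c ⊕ Fin m) K (LattK K n), ⇑b = frame P σ p := by
  have hdet : IsUnit ((σ.basis.baseChange K).det (frame P σ p)) := by
    rw [det_frame σ hu hp]
    exact isUnit_one.neg.pow _
  obtain ⟨hli, hspan⟩ := (Module.Basis.is_basis_iff_det _).2 hdet
  exact ⟨Module.Basis.mk hli hspan.ge, Module.Basis.coe_mk _ _⟩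

variable {u' : Fin c → DualLatt n} {q' : Latt n →+ Latt m} {P' : NefPartition Y L}
  {p' : AddChar (Latt n) K}

theorem det_frame_frame_sq {σ : Splitting u q} {σ' : Splitting u' q'} (hu : P.IsAmenable u)
    (hu' : P'.IsAmenable u') (hp : OnLocus P p) (hp' : OnLocus P' p')
    {b : Module.Basis (Fin c ⊕ Fin m) K (LattK K n)} (hb : ⇑b = frame P σ p)
    {b' : Module.Basis (Fin c ⊕ Fin m) K (LattK K n)} (hb' : ⇑b' = frame P' σ' p') :
    b'.det b ^ 2 = 1 := by
  let e := σ.basis.baseChange K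
  let e' := σ'.basis.baseChange K
  have hsign (k : ℕ) : (((-1) ^ k : K)) ^ 2 = 1 := by rw [← pow_mul, pow_mul', neg_one_sq, one_pow]
  have hbe : e.det b ^ 2 = 1 := by rw [hb, det_frame σ hu hp, hsign]
  have hbe' : e'.det b' ^ 2 = 1 := by rw [hb', det_frame σ' hu' hp', hsign]
  calc b'.det b ^ 2 = (e'.det b' * b'.det b) ^ 2 := by rw [mul_pow, hbe', one_mul]
    _ = (e'.det e * e.det b) ^ 2 := by rw [e'.det_mul_det b' b, e'.det_mul_det e b]
    _ = 1 := by rw [mul_pow, hbe, det_baseChange_sq, one_mul]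

end frame

theorem isVolumePreserving_of_jacobian {n m c : ℕ} {u u' : Fin c → DualLatt n}
    {q q' : Latt n →+ Latt m} {ι : Type*} [DecidableEq ι] [Fintype ι] {Y : SmoothCompleteFan n ι}
    {L : Fin c → Y.Pic} {P P' : NefPartition Y L} (σ : Splitting u q) (σ' : Splitting u' q')
    (hu : P.IsAmenable u) (hu' : P'.IsAmenable u') {p p' : AddChar (Latt n) (FunField m)}
    (hp : OnLocus P p) (hp' : OnLocus P' p')
    (hgen : p'.compAddMonoidHom σ'.incl = genericPoint m)
    {A : Module.End (FunField m) (LattK (FunField m) n)} (hA : LinearMap.det A ^ 2 = 1)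
    (hdlog : dlogMap p = dlogMap p' ∘ₗ A)
    (hgrad : ∀ a, A (grad P.part Y.ray p a) = grad P'.part Y.ray p' a) {φ : BirMap m}
    (hφ : ∀ i, φ (coord m i) = p (σ.incl (Pi.single i 1))) : IsVolumePreserving φ := by
  obtain ⟨b, hb⟩ := exists_basis_eq_frame σ hu hp
  obtain ⟨b', hb'⟩ := exists_basis_eq_frame σ' hu' hp'
  have hzero (i) : dlogMap p' (b' (Sum.inl i)) = 0 := by
    have hG := hp' i
    rw [NefPartition.S] at hG
    rw [hb', frame, Sum.elim_inl, dlogMap_grad, hG, Derivation.map_one_eq_zero]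
  have hinl : A ∘ b = Sum.elim (b' ∘ Sum.inl) (A ∘ b ∘ Sum.inr) := by
    ext (i | j)
    · simp [hb, hb', frame, hgrad]
    · rfl
  have hcoord (j) : dlogMap p' (b' (Sum.inr j)) = dlog (coord m j) := by
    rw [hb', frame, Sum.elim_inr, dlogMap_vec, coord, ← genericPoint_apply, ← hgen]
    rfl
  have hφcoord (j) : dlog (φ (coord m j)) = dlogMap p' (A (b (Sum.inr j))) := by
    rw [hφ, hb, frame, Sum.elim_inr, ← dlogMap_vec, hdlog, LinearMap.comp_apply]
  have hform : dlogForm (fun i => φ (coord m i))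
      = (LinearMap.det A * b'.det b) • dlogForm (coord m) := by
    rw [← Module.Basis.det_comp, hinl]
    refine (congrArg (exteriorPower.ιMulti (FunField m) m) (funext hφcoord)).trans ?_
    refine (alternatingMap_comp_of_apply_inl_eq_zero b' hzero _ (A ∘ b ∘ Sum.inr)).trans ?_
    exact congrArg (_ • exteriorPower.ιMulti (FunField m) m ·) (funext hcoord)
  have hsq : (LinearMap.det A * b'.det b) ^ 2 = 1 := by
    rw [mul_pow, hA, det_frame_frame_sq hu hu' hp hp' hb hb', one_mul]
  rw [IsVolumePreserving, hform]
  refine (sq_eq_one_iff.1 hsq).imp (fun h => ?_) fun h => ?_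
  · rw [h, one_smul]
  · rw [h]
    exact neg_one_smul (FunField m) (dlogForm (coord m))

/-! ### Mutation equivalence of the mirrors -/

section main

variable {n c : ℕ} {ι : Type*} [DecidableEq ι] [Fintype ι]
  {Y : SmoothCompleteFan n ι} {L : Fin c → Y.Pic}

theorem exists_pos_relation (Y : SmoothCompleteFan n ι) :
    ∃ x : ι → ℝ, (∀ j, 0 < x j) ∧ ∑ j, x j • (fun k => (Y.ray j k : ℝ)) = 0 := by
  obtain ⟨σ, -, x, hx, hsum⟩ := Y.complete (-∑ j, fun k => (Y.ray j k : ℝ))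
  refine ⟨fun j => 1 + if j ∈ σ then x j else 0, fun j => ?_, ?_⟩
  · have : 0 ≤ if j ∈ σ then x j else 0 := by
      split_ifs
      exacts [hx j, le_rfl]
    positivity
  · simp only [add_smul, one_smul, sum_add_distrib, ite_smul, zero_smul, sum_ite_mem, univ_inter]
    rw [add_eq_zero_iff_neg_eq, hsum]

theorem exists_pos_dual_relation (Y : SmoothCompleteFan n ι) :
    ∃ x : ι → ℝ, (∀ j, 0 < x j) ∧ ∀ w : DualLatt n, ∑ j, x j * (w (Y.ray j) : ℝ) = 0 := by
  obtain ⟨x, hpos, hx⟩ := exists_pos_relation Y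
  refine ⟨x, hpos, fun w => ?_⟩
  have hw (v : Latt n) : (w v : ℝ)
      = Fintype.linearCombination ℝ (fun k => (w (Pi.single k 1) : ℝ)) fun k => (v k : ℝ) := by
    conv_lhs => rw [← (Pi.basisFun ℤ (Fin n)).sum_repr v]
    simp only [Pi.basisFun_repr, Pi.basisFun_apply, map_sum, map_smul, smul_eq_mul, Int.cast_sum,
      Int.cast_mul, Fintype.linearCombination_apply]
  have hwx := congrArg (Fintype.linearCombination ℝ fun k => (w (Pi.single k 1) : ℝ)) hx
  simpa only [map_sum, map_smul, map_zero, ← hw, smul_eq_mul] using hwx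

omit [Fintype ι] in
theorem sum_D_eq_cls (Y : SmoothCompleteFan n ι) (t : Finset ι) :
    ∑ j ∈ t, Y.D j = Y.cls fun j => if j ∈ t then 1 else 0 := by
  have hcls : ∑ j ∈ t, Y.D j = Y.cls (∑ j ∈ t, Pi.single j 1) :=
    (map_sum (LinearMap.range Y.rhoStar).mkQ _ t).symm
  rw [hcls]
  congr 1
  ext j
  simp [Finset.sum_apply, Pi.single_apply]

theorem exists_transition_castSucc (P P' : NefPartition Y L) (i : Fin c) :
    ∃ w : DualLatt n, ∀ j, w (Y.ray j)
      = (if P.part j = i.castSucc then 1 else 0) - if P'.part j = i.castSucc then 1 else 0 := by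
  have h := (P.sum_eq i).trans (P'.sum_eq i).symm
  rw [sum_D_eq_cls, sum_D_eq_cls] at h
  obtain ⟨w, hw⟩ := (Submodule.Quotient.eq _).1 h
  refine ⟨w, fun j => (congrFun hw j).trans ?_⟩
  simp

theorem exists_isTransition (P P' : NefPartition Y L) :
    ∃ M, IsTransition P.part P'.part Y.ray M := by
  choose w hw using exists_transition_castSucc P P'
  refine ⟨Fin.lastCases (-∑ i, w i) w, fun a j => ?_⟩
  beta_reduce
  induction a using Fin.lastCases with
  | cast i => rw [Fin.lastCases_castSucc, hw]
  | last =>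
    have hsum (b : Fin (c + 1)) : (∑ i : Fin c, if b = i.castSucc then (1 : ℤ) else 0)
        = 1 - if b = Fin.last c then 1 else 0 := by
      rw [eq_sub_iff_add_eq, ← Fin.sum_univ_castSucc fun i => if b = i then (1 : ℤ) else 0,
        Fintype.sum_ite_eq]
    rw [Fin.lastCases_last, LinearMap.neg_apply, LinearMap.sum_apply]
    simp only [hw, sum_sub_distrib, hsum]
    ring

omit [Fintype ι] in
theorem exists_isRoot_of_isTransition {J : Type*} [DecidableEq J] [Finite J] [Finite ι]
    {src tgt : ι → J} {M : J → DualLatt n} (hM : IsTransition src tgt Y.ray M) :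
    ∃ root, IsRoot src tgt root := by
  cases nonempty_fintype ι
  obtain ⟨x, hpos, hx⟩ := exists_pos_dual_relation Y
  refine exists_isRoot hpos fun b => ?_
  have h := hx (M b)
  simp only [hM _ _, Int.cast_sub, Int.cast_ite, Int.cast_one, Int.cast_zero, mul_sub, mul_ite,
    mul_one, mul_zero, sum_sub_distrib] at h
  rw [sum_filter, sum_filter]
  exact sub_eq_zero.1 h

variable {m : ℕ} {P P' : NefPartition Y L} {u u' : Fin c → DualLatt n} {s s' : Fin c → ι}
  {q q' : Latt n →+ Latt m}

section point

variable {K : Type*} [Field K] {p : AddChar (Latt n) K} {M : Fin (c + 1) → DualLatt n}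
  {B : Fin (c + 1) → K} {root : Fin (c + 1) → Fin (c + 1)}

theorem OnLocus.twist (hp : OnLocus P' p) (hB : ∀ a, B a ≠ 0)
    (hM : IsTransition P.part P'.part Y.ray M)
    (hst : IsStationary P.part P'.part root (fun j => p (Y.ray j)) B) :
    OnLocus P (twist p M hB) := fun i =>
  (sum_twist_ray hB hM hst i.castSucc).trans (hp i)

theorem sum_twist_ray_univ (hB : ∀ a, B a ≠ 0) (hM : IsTransition P.part P'.part Y.ray M)
    (hst : IsStationary P.part P'.part root (fun j => p (Y.ray j)) B) :
    ∑ j, twist p M hB (Y.ray j) = ∑ j, p (Y.ray j) := by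
  rw [← sum_fiberwise univ P.part, ← sum_fiberwise univ P'.part fun j => p (Y.ray j)]
  exact sum_congr rfl fun a _ => sum_twist_ray hB hM hst a

end point

theorem residueField_comp_incl_eq_top (σ : Splitting u q) (σ' : Splitting u' q')
    (hu : P.IsAmenable u) (hqs : ∀ i, q (Y.ray (s i)) = 0) {p p' : AddChar (Latt n) (FunField m)}
    (hp : OnLocus P p) (hp' : ∀ w, p' w ∈ residueField p)
    (hgen : p'.compAddMonoidHom σ'.incl = genericPoint m) :
    residueField (p.compAddMonoidHom σ.incl) = ⊤ := by
  have hle : residueField p ≤ residueField (p.compAddMonoidHom σ.incl) :=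
    (residueField_le_iff).2 (σ.apply_mem_residueField hu hqs hp)
  rw [eq_top_iff, ← residueField_genericPoint, residueField_le_iff, ← hgen]
  exact fun w => hle (hp' _)

theorem mutationEquivalent_of_splittings (σ : Splitting u q) (σ' : Splitting u' q')
    (hu : P.IsAmenable u) (hu' : P'.IsAmenable u') (hs' : ∀ i, s' i ∈ P'.S i.castSucc)
    (hqs : ∀ i, q (Y.ray (s i)) = 0) (hqs' : ∀ i, q' (Y.ray (s' i)) = 0) :
    MutationEquivalent (AddMonoidAlgebra.mapDomain q (totalPull P u s))
      (AddMonoidAlgebra.mapDomain q' (totalPull P' u' s')) := by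
  obtain ⟨p', hgen, hp', hpos⟩ := σ'.exists_generic_point_of_locus hu' hs' hqs'
  obtain ⟨M, hM⟩ := exists_isTransition P P'
  obtain ⟨root, hr⟩ := exists_isRoot_of_isTransition hM
  obtain ⟨B, hst, hBpos⟩ := exists_isStationary_mem_posAtOne hr fun j => hpos (Y.ray j)
  have hB (a) : B a ≠ 0 := ne_zero_of_mem_posAtOne (hBpos a)
  have hp : OnLocus P (twist p' M hB) := hp'.twist hB hM hst
  have hdet := isUnit_det_dirichletMat_of_mem_posAtOne hr fun j => hpos (Y.ray j)
  obtain ⟨κ, hκ⟩ := exists_isGradient hr hdet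
  obtain ⟨φ, hφ⟩ := exists_birMap (residueField_comp_incl_eq_top σ σ' hu hqs hp
    (apply_mem_residueField_twist hr hM (fun j => hpos _) hst hBpos) hgen)
  refine ⟨φ, isVolumePreserving_of_jacobian σ σ' hu hu' hp hp' hgen
    (det_jac_sq hB hM hdet hst hκ) (dlogMap_twist hB (hκ.dlogMap_eq hdet hst))
    (jac_grad_twist hB hM hst hκ) fun i => ?_, ?_⟩
  · rw [coord, hφ, evalAt_mono]
    rfl
  · rw [hφ, σ.evalAt_mirror hu hqs hp, sum_twist_ray_univ hB hM hst,
      ← σ'.evalAt_mirror hu' hqs' hp', hgen, evalAt_genericPoint]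

theorem mutationEquivalent_of_isLaurentMirror {f f' : Laurent (n - c)} (hu : P.IsAmenable u)
    (hs : ∀ i, s i ∈ P.S i.castSucc) (hf : IsLaurentMirror P u s f) (hu' : P'.IsAmenable u')
    (hs' : ∀ i, s' i ∈ P'.S i.castSucc) (hf' : IsLaurentMirror P' u' s' f') :
    MutationEquivalent f f' := by
  obtain ⟨q, hq, hker, rfl⟩ := hf.exists_eq_mapDomain hu hs
  obtain ⟨q', hq', hker', rfl⟩ := hf'.exists_eq_mapDomain hu' hs'
  have hqs (i) : q (Y.ray (s i)) = 0 :=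
    AddMonoidHom.mem_ker.1 (hker ▸ AddSubgroup.subset_closure ⟨i, rfl⟩)
  have hqs' (i) : q' (Y.ray (s' i)) = 0 :=
    AddMonoidHom.mem_ker.1 (hker' ▸ AddSubgroup.subset_closure ⟨i, rfl⟩)
  exact mutationEquivalent_of_splittings (splitting hu hs hq hker) (splitting hu' hs' hq' hker')
    hu hu' hs' hqs hqs'

end main

end ToricLG

end

theorem corollary1_general {n c : ℕ} {ι : Type*} [DecidableEq ι] [Fintype ι]
    (Y : ToricLG.SmoothCompleteFan n ι) (L : Fin c → Y.Pic) :
    (∀ (P : ToricLG.NefPartition Y L) (u : Fin c → ToricLG.DualLatt n) (s : Fin c → ι),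
      P.IsAmenable u → (∀ i, s i ∈ P.S i.castSucc) →
        c ≤ n ∧ ∃ f : ToricLG.Laurent (n - c), ToricLG.IsLaurentMirror P u s f) ∧
    (∀ (P P' : ToricLG.NefPartition Y L) (u u' : Fin c → ToricLG.DualLatt n) (s s' : Fin c → ι)
      (f f' : ToricLG.Laurent (n - c)),
      P.IsAmenable u → (∀ i, s i ∈ P.S i.castSucc) → ToricLG.IsLaurentMirror P u s f →
      P'.IsAmenable u' → (∀ i, s' i ∈ P'.S i.castSucc) → ToricLG.IsLaurentMirror P' u' s' f' →
        ToricLG.MutationEquivalent f f') := by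
  refine ⟨fun P u s hu hs => ?_, fun P P' u u' s s' f f' hu hs hf hu' hs' hf' =>
    ToricLG.mutationEquivalent_of_isLaurentMirror hu hs hf hu' hs' hf'⟩
  obtain ⟨hcn, q, hq, hker⟩ := ToricLG.exists_quotient_coordinates hu hs
  exact ⟨hcn, ToricLG.exists_isLaurentMirror hu hs hq hker⟩

theorem corollary1 {n c : ℕ} {ι : Type*} [DecidableEq ι] [Fintype ι]
    (Y : ToricLG.SmoothCompleteFan n ι) (_hY : Y.IsFano)
    (L : Fin c → Y.Pic) (_hL : ∀ i, Y.IsNef (L i))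
    (_hΛ : Y.IsAmple (Y.antiK - ∑ i, L i)) :
    -- every amenable collection gives rise to a Laurent polynomial mirror in `n - c` variables
    (∀ (P : ToricLG.NefPartition Y L) (u : Fin c → ToricLG.DualLatt n) (s : Fin c → ι),
      P.IsAmenable u → (∀ i, s i ∈ P.S i.castSucc) →
        c ≤ n ∧ ∃ f : ToricLG.Laurent (n - c), ToricLG.IsLaurentMirror P u s f) ∧
    -- any two of these mirrors are mutation equivalent
    (∀ (P P' : ToricLG.NefPartition Y L) (u u' : Fin c → ToricLG.DualLatt n) (s s' : Fin c → ι)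
      (f f' : ToricLG.Laurent (n - c)),
      P.IsAmenable u → (∀ i, s i ∈ P.S i.castSucc) → ToricLG.IsLaurentMirror P u s f →
      P'.IsAmenable u' → (∀ i, s' i ∈ P'.S i.castSucc) → ToricLG.IsLaurentMirror P' u' s' f' →
        ToricLG.MutationEquivalent f f') :=
  corollary1_general Y L
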